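/- Let $n\ge 2$ and write $x=(x',x_n)\in\mathbb R^{n-1}\times\mathbb R$. Let $\Omega\subset\mathbb R^n$ be an open set (an infinitely long nozzle) such that, for some $\alpha\in(0,1)$ and $K<\infty$, there is a bijection $T:\overline\Omega\to\overline{\mathcal C}$ onto the closure of the unit cylinder $\mathcal C=B(0,1)\times\mathbb R$ ($B(0,1)$ the unit ball of $\mathbb R^{n-1}$) with $T(\partial\Omega)=\partial\mathcal C$ and $T(\Omega\cap\{x_n=k\})=B(0,1)\times\{k\}$ for every $k\in\mathbb R$, where $T$ and $T^{-1}$ are of class $C^{2,\alpha}$ up to the boundary and their first derivatives, their second derivatives and the $\alpha$-Hölder seminorms of their second derivatives are bounded by $K$. Let $p$ be a pressure law, smooth on $(0,\infty)$ with $p'>0$ and $p''>0$, and let $\rho=\rho(q^2)>0$, $0\le q\le1$, be the density determined by Bernoulli's law $\tfrac12q^2+h(\rho(q^2))=\mathrm{const}$, $h(\rho)=\int_1^\rho\frac{p'(s)}{s}\,ds$, normalized so that the critical speed and the critical density are one: $\rho(1)=1$ and $p'(\rho(1))=1$. Let $0<\tilde\delta_0<\tfrac12$ and let $\Theta:[0,\infty)\to\mathbb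 R$ be smooth and nonincreasing with $\Theta(s)=\rho(s)$ for $0\le s<1-2\tilde\delta_0$ and $\Theta(s)=\rho(1-\tilde\delta_0)$ for $s>1-\tilde\delta_0$. Set $F(t)=\frac12\int_0^t\Theta(s)\,ds$. For $L>0$ put $\Omega_L=\{x\in\Omega:|x_n|<L\}$ and $S_L^\pm=\Omega\cap\{x_n=\pm L\}$, let $H_L=\{\psi\in H^1(\Omega_L):\psi|_{S_L^-}=0\}$ (in the sense of traces), and for $m_0>0$ let $$J(\psi)=\int_{\Omega_L}F(|\nabla\psi|^2)\,dx-\frac{m_0}{|S_L^+|}\int_{S_L^+}\psi\,dx',\qquad\psi\in H_L .$$ For $x_0=(x_0',x_{0,n})\in\Omega$ and $r>0$ put $\Omega_{x_0,r}=\{x\in\Omega:|x_n-x_{0,n}|<r\}$. **Local average estimate.** There is a constant $C>0$, depending only on $\Omega$ and $\Theta$ (in particular independent of $x_0$, $L$, $m_0$ and $\varphi$), such that for every $m_0>0$, every $L\ge2$, every minimizer $\varphi$ of $J$ over $H_L$, and every $x_0\in\Omega$ with $|x_{0,n}|<\frac L2$, $$\frac1{|\Omega_{x_0,1}|}\int_{\Omega_{x_0,1}}|\nabla\varphi|^2\,dx\le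 C\,m_0^2 .$$ -/

import Mathlib

open MeasureTheory Filter Topology Set
open scoped ContDiff

noncomputable section

namespace Nozzle

/-! Points of `ℝⁿ`, `n = d + 1`, are written `x = (x', xₙ)` with `x' ∈ ℝᵈ`; the longitudinal
coordinate `xₙ` is the coordinate with index `Fin.last d`. -/

/-- `ℝⁿ` with `n = d + 1`, with its Euclidean norm. -/
abbrev Space (d : ℕ) : Type := EuclideanSpace ℝ (Fin (d + 1))

/-- The cross-sectional space `ℝⁿ⁻¹ = ℝᵈ`. -/
abbrev Section (d : ℕ) : Type := EuclideanSpace ℝ (Fin d)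

/-- The longitudinal coordinate `xₙ`. -/
def lastCoord {d : ℕ} (x : Space d) : ℝ := x (Fin.last d)

/-- The point `(x', t)`. -/
def mkPoint {d : ℕ} (x' : Section d) (t : ℝ) : Space d :=
  WithLp.toLp 2 (Fin.snoc (α := fun _ => ℝ) (fun i => x' i) t)

/-! ### The nozzle -/

/-- The unit cylinder `B(0,1) × (-∞, ∞)`. -/
def unitCylinder (d : ℕ) : Set (Space d) :=
  {y | ∑ i : Fin d, y (Fin.castSucc i) ^ 2 < 1}

/-- `f` is a `C^{2,α}` map on the closure of the open set `U`, whose derivatives of order one and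
two and whose `α`-Hölder seminorm of the second derivative are bounded by `K`.
(The values of `f` itself are not required to be bounded: the maps below preserve the unbounded
longitudinal coordinate.) -/
structure IsC2Holder {d : ℕ} (U : Set (Space d)) (α K : ℝ) (f : Space d → Space d) : Prop where
  continuousOn : ContinuousOn f (closure U)
  contDiffOn : ContDiffOn ℝ 2 f U
  norm_fderiv_le : ∀ x ∈ U, ‖fderiv ℝ f x‖ ≤ K
  norm_fderiv_two_le : ∀ x ∈ U, ‖iteratedFDeriv ℝ 2 f x‖ ≤ K
  holder : ∀ x ∈ U, ∀ y ∈ U,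
    ‖iteratedFDeriv ℝ 2 f x - iteratedFDeriv ℝ 2 f y‖ ≤ K * ‖x - y‖ ^ α

/-- The basic assumptions on the nozzle `Ω`: there is an invertible `C^{2,α}` map
`T : closure Ω → closure (cylinder)`, with inverse `R`, which takes boundary to boundary and every
cross section `Ω ∩ {xₙ = k}` onto `B(0,1) × {k}`, with uniform bounds on `T` and `R = T⁻¹`. -/
def IsNozzle {d : ℕ} (Ω : Set (Space d)) : Prop :=
  IsOpen Ω ∧
  ∃ α K : ℝ, 0 < α ∧ α < 1 ∧
  ∃ T R : Space d → Space d,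
    BijOn T (closure Ω) (closure (unitCylinder d)) ∧
    InvOn R T (closure Ω) (closure (unitCylinder d)) ∧
    T '' frontier Ω = frontier (unitCylinder d) ∧
    (∀ k : ℝ, T '' {x ∈ Ω | lastCoord x = k} = {y ∈ unitCylinder d | lastCoord y = k}) ∧
    IsC2Holder Ω α K T ∧
    IsC2Holder (unitCylinder d) α K R

/-- The truncated nozzle `Ω_L = {x ∈ Ω : |xₙ| < L}`. -/
def truncated {d : ℕ} (Ω : Set (Space d)) (L : ℝ) : Set (Space d) :=
  {x ∈ Ω | |lastCoord x| < L}

/-- The slab `Ω_{x₀,r} = {x ∈ Ω : |xₙ - x₀ₙ| < r}`. -/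
def slab {d : ℕ} (Ω : Set (Space d)) (x₀ : Space d) (r : ℝ) : Set (Space d) :=
  {x ∈ Ω | |lastCoord x - lastCoord x₀| < r}

/-- The cross section `Ω ∩ {xₙ = t}`, as a subset of `ℝⁿ⁻¹`. -/
def crossSection {d : ℕ} (Ω : Set (Space d)) (t : ℝ) : Set (Section d) :=
  {x' | mkPoint x' t ∈ Ω}

/-! ### The gas and the subsonic truncation -/

/-- A pressure law: `p` is smooth, with `p' > 0` and `p'' > 0`, on `(0, ∞)`. -/
structure IsPressureLaw (p : ℝ → ℝ) : Prop where
  smooth : ContDiffOn ℝ ∞ p (Ioi 0)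
  deriv_pos : ∀ r, 0 < r → 0 < deriv p r
  deriv_deriv_pos : ∀ r, 0 < r → 0 < deriv (deriv p) r

/-- The enthalpy `h(ρ) = ∫₁^ρ p'(s)/s ds`. -/
def enthalpy (p : ℝ → ℝ) (r : ℝ) : ℝ := ∫ s in (1 : ℝ)..r, deriv p s / s

/-- `ρ`, as a function of the squared speed `s = q² ∈ [0, 1]`, is the density-speed relation of the
pressure law `p`: Bernoulli's law `q²/2 + h(ρ(q²)) = const` holds, in the units in which the
critical speed is one (the speed `q = 1` is the speed of sound `c = √p'(ρ)`) and so is the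
critical density. -/
structure IsDensitySpeedRelation (p ρ : ℝ → ℝ) : Prop where
  pos : ∀ s ∈ Icc (0 : ℝ) 1, 0 < ρ s
  bernoulli : ∃ B : ℝ, ∀ s ∈ Icc (0 : ℝ) 1, s / 2 + enthalpy p (ρ s) = B
  sonic : deriv p (ρ 1) = 1
  critical_density : ρ 1 = 1

/-- `Θ`, as a function of the squared speed, is a subsonic truncation of `ρ` with parameter `δ`. -/
structure IsSubsonicTruncation (ρ : ℝ → ℝ) (δ : ℝ) (Θ : ℝ → ℝ) : Prop where
  smooth : ContDiffOn ℝ ∞ Θ (Ici 0)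
  antitone : AntitoneOn Θ (Ici 0)
  eq_subsonic : ∀ s, 0 ≤ s → s < 1 - 2 * δ → Θ s = ρ s
  eq_const : ∀ s, 1 - δ < s → Θ s = ρ (1 - δ)

/-- `F(t) = ½ ∫₀ᵗ Θ(s) ds`, to be evaluated at `t = q²`. -/
def energyDensity (Θ : ℝ → ℝ) (t : ℝ) : ℝ := (1 / 2) * ∫ s in (0 : ℝ)..t, Θ s

/-! ### The space `H_L` and the variational problem -/

/-- `g` is the weak gradient of `u` on the open set `U`. -/
def IsWeakGradient {d : ℕ} (U : Set (Space d)) (u : Space d → ℝ) (g : Space d → Space d) : Prop :=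
  ∀ ζ : Space d → ℝ, ContDiff ℝ ∞ ζ → HasCompactSupport ζ → tsupport ζ ⊆ U →
    ∫ x in U, u x • gradient ζ x = - ∫ x in U, ζ x • g x

/-- The traces on `S_L^-` and `S_L^+` of a function `u ∈ H¹(Ω_L)` with weak gradient `g` are `τ₁`
and `τ₂`. The trace is the continuous extension of the restriction of smooth functions: some
sequence of functions smooth up to the boundary converges to `u` in `H¹(Ω_L)`, while its
restrictions to `S_L^-` and `S_L^+` converge to `τ₁` and `τ₂` in `L²`. -/
def HasTraces {d : ℕ} (Ω : Set (Space d)) (L : ℝ) (u : Space d → ℝ) (g : Space d → Space d)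
    (τ₁ τ₂ : Section d → ℝ) : Prop :=
  ∃ w : ℕ → Space d → ℝ, (∀ k, ContDiff ℝ ∞ (w k)) ∧
    Tendsto (fun k => eLpNorm (fun x => w k x - u x) 2 (volume.restrict (truncated Ω L)))
      atTop (𝓝 0) ∧
    Tendsto (fun k => eLpNorm (fun x => gradient (w k) x - g x) 2
      (volume.restrict (truncated Ω L))) atTop (𝓝 0) ∧
    Tendsto (fun k => eLpNorm (fun x' => w k (mkPoint x' (-L)) - τ₁ x') 2
      (volume.restrict (crossSection Ω (-L)))) atTop (𝓝 0) ∧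
    Tendsto (fun k => eLpNorm (fun x' => w k (mkPoint x' L) - τ₂ x') 2
      (volume.restrict (crossSection Ω L))) atTop (𝓝 0)

/-- An element of `H_L = {φ ∈ H¹(Ω_L) : φ = 0 on S_L^-}`, together with its weak gradient and its
trace on `S_L^+` (both of which it determines almost everywhere). -/
structure HL {d : ℕ} (Ω : Set (Space d)) (L : ℝ) where
  val : Space d → ℝ
  grad : Space d → Space d
  trace : Section d → ℝ
  memLp_val : MemLp val 2 (volume.restrict (truncated Ω L))
  memLp_grad : MemLp grad 2 (volume.restrict (truncated Ω L))
  memLp_trace : MemLp trace 2 (volume.restrict (crossSection Ω L))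
  isWeakGradient : IsWeakGradient (truncated Ω L) val grad
  hasTraces : HasTraces Ω L val grad (fun _ => 0) trace

/-- `J(ψ) = ∫_{Ω_L} F(|∇ψ|²) dx - (m₀ / |S_L^+|) ∫_{S_L^+} ψ dx'`. -/
def functional {d : ℕ} (Ω : Set (Space d)) (Θ : ℝ → ℝ) (m₀ L : ℝ) (ψ : HL Ω L) : ℝ :=
  (∫ x in truncated Ω L, energyDensity Θ (‖ψ.grad x‖ ^ 2)) -
    m₀ / volume.real (crossSection Ω L) * ∫ x' in crossSection Ω L, ψ.trace x'

/-- `φ ∈ H_L` solves the truncated variational problem `J(φ) = min_{ψ ∈ H_L} J(ψ)`. -/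
def IsMinimizer {d : ℕ} (Ω : Set (Space d)) (Θ : ℝ → ℝ) (m₀ L : ℝ) (φ : HL Ω L) : Prop :=
  ∀ ψ : HL Ω L, functional Ω Θ m₀ L φ ≤ functional Ω Θ m₀ L ψ

end Nozzle

end

noncomputable section

open scoped ENNReal NNReal

namespace Nozzle

/-! The proof is a Caccioppoli-type "hole-filling" argument that propagates along the nozzle. Write
`E(r)` for the integral of `|∇φ|²` over the slab of half-width `r` around height `z`.

On the two unit layers bounding the slab of half-width `r + 1`, `φ` is close in `L²` to constants
`c₁` (below) and `c₂` (above), by Poincaré. The competitor equals `φ` below the slab, the constant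
`c₁` inside, and `φ + c₁ - c₂` above, with smooth transitions in the layers. Its gradient vanishes
inside and equals `∇φ` outside, so minimality bounds `E(r + 1)` by the energy of the layers, `E(r +
1) - E(r)`, plus the boundary term `m₀ |c₁ - c₂|`. A Poincaré inequality on the whole slab gives
`|c₁ - c₂|² ≤ C r³ E(r + 1)`, so Young's inequality absorbs that term at the price of `C r³ m₀²`.
The result is `E(r) ≤ θ E(r + 1) + D r³ m₀²` with `θ < 1` (`IsFlattening.exists_energy_decay`).

Comparison with the zero function and a trace inequality give the crude global bound `C L m₀²`
(`IsFlattening.exists_energy_le`). Iterating the decay about `L / 2` times multiplies this bound by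
a power of `θ` that beats the factor `L`, while `∑ i³ θ^i` converges; hence `E(1) ≤ C m₀²`
(`IsFlattening.exists_local_energy_le`).

All constants are uniform in position because the flattening maps compare every slab with a slab of
the straight cylinder, which is convex. The gas enters only through the two-sided linear growth and
monotonicity of `F` (`HasLinearGrowth`). Poincaré and trace inequalities are proved for smooth
functions and passed to `H_L` by the approximation built into the definition of traces. -/

/-! ### Poincaré inequalities on convex sets. -/

theorem sq_lintegral_le {α : Type*} [MeasurableSpace α] (μ : Measure α) {f : α → ℝ≥0∞}
    (hf : AEMeasurable f μ) : (∫⁻ a, f a ∂μ) ^ 2 ≤ μ univ * ∫⁻ a, f a ^ 2 ∂μ := by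
  have hpq : (2 : ℝ).HolderConjugate 2 := Real.HolderConjugate.two_two
  have h := ENNReal.lintegral_mul_le_Lp_mul_Lq μ hpq hf (g := fun _ => 1) aemeasurable_const
  simp only [Pi.mul_apply, mul_one, ENNReal.one_rpow, lintegral_const, one_mul] at h
  have h2 := pow_le_pow_left' h 2
  refine h2.trans_eq ?_
  rw [mul_pow, ← ENNReal.rpow_natCast, ← ENNReal.rpow_mul, ← ENNReal.rpow_natCast,
    ← ENNReal.rpow_mul, mul_comm]
  norm_num

/-- Fundamental theorem of calculus along the segment, then Cauchy–Schwarz in the parameter. -/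
theorem enorm_sub_sq_le_lintegral_fderiv {E : Type*} [NormedAddCommGroup E] [NormedSpace ℝ E]
    {U : Set E} (hU : IsOpen U) {u : E → ℝ} (hu : ContDiffOn ℝ 1 u U) {x y : E}
    (hxy : segment ℝ x y ⊆ U) :
    ‖u y - u x‖ₑ ^ 2 ≤ ‖y - x‖ₑ ^ 2 *
      ∫⁻ τ in Ioc (0 : ℝ) 1, ‖fderiv ℝ u ((1 - τ) • x + τ • y)‖ₑ ^ 2 := by
  set γ : ℝ → E := fun τ => (1 - τ) • x + τ • y with hγ
  have hγU : ∀ τ ∈ Icc (0 : ℝ) 1, γ τ ∈ U := fun τ hτ =>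
    hxy ⟨1 - τ, τ, by linarith [hτ.2], hτ.1, by ring, rfl⟩
  have hγd : ∀ τ, HasDerivAt γ (y - x) τ := by
    intro τ
    have h1 := (((hasDerivAt_id τ).const_sub 1).smul_const x).add
      ((hasDerivAt_id τ).smul_const y)
    refine h1.congr_deriv ?_
    rw [neg_one_smul, one_smul, neg_add_eq_sub]
  have hγc : Continuous γ := by fun_prop
  have hD : ∀ τ ∈ Icc (0 : ℝ) 1, HasDerivAt (fun s => u (γ s)) (fderiv ℝ u (γ τ) (y - x)) τ := by
    intro τ hτ
    have h1 : DifferentiableAt ℝ u (γ τ) :=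
      (hu.differentiableOn one_ne_zero).differentiableAt (hU.mem_nhds (hγU τ hτ))
    exact h1.hasFDerivAt.comp_hasDerivAt τ (hγd τ)
  have hc : ContinuousOn (fun τ => fderiv ℝ u (γ τ)) (Icc 0 1) :=
    (hu.continuousOn_fderiv_of_isOpen hU le_rfl).comp hγc.continuousOn hγU
  have hc' : ContinuousOn (fun τ => fderiv ℝ u (γ τ) (y - x)) (Icc 0 1) :=
    hc.clm_apply continuousOn_const
  have hint := intervalIntegral.integral_eq_sub_of_hasDerivAt (a := 0) (b := 1)
    (f := fun s => u (γ s)) (f' := fun τ => fderiv ℝ u (γ τ) (y - x))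
    (by simpa using hD) (by
      apply ContinuousOn.intervalIntegrable
      simpa using hc')
  have h01 : u (γ 1) - u (γ 0) = u y - u x := by simp [hγ]
  rw [h01, intervalIntegral.integral_of_le zero_le_one] at hint
  rw [← hint]
  have hm : AEMeasurable (fun τ => ‖fderiv ℝ u (γ τ)‖ₑ) (volume.restrict (Ioc (0 : ℝ) 1)) :=
    ((hc.mono Ioc_subset_Icc_self).aestronglyMeasurable measurableSet_Ioc).enorm
  calc ‖∫ τ in Ioc (0 : ℝ) 1, fderiv ℝ u (γ τ) (y - x)‖ₑ ^ 2
      ≤ (∫⁻ τ in Ioc (0 : ℝ) 1, ‖fderiv ℝ u (γ τ) (y - x)‖ₑ) ^ 2 := by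
        gcongr; exact enorm_integral_le_lintegral_enorm _
    _ ≤ (∫⁻ τ in Ioc (0 : ℝ) 1, ‖fderiv ℝ u (γ τ)‖ₑ * ‖y - x‖ₑ) ^ 2 := by
        gcongr; exact ContinuousLinearMap.le_opENorm _ _
    _ = ‖y - x‖ₑ ^ 2 * (∫⁻ τ in Ioc (0 : ℝ) 1, ‖fderiv ℝ u (γ τ)‖ₑ) ^ 2 := by
        rw [lintegral_mul_const'' _ hm, mul_pow, mul_comm]
    _ ≤ _ := by
        gcongr
        refine (sq_lintegral_le _ hm).trans_eq ?_
        simp [hγ]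

theorem lintegral_comp_add_smul {E : Type*} [NormedAddCommGroup E] [NormedSpace ℝ E]
    [MeasurableSpace E] [BorelSpace E] [FiniteDimensional ℝ E] (μ : Measure E)
    [μ.IsAddHaarMeasure] {H : E → ℝ≥0∞} (hH : Measurable H) (a : E) {t : ℝ} (ht : t ≠ 0) :
    ∫⁻ y, H (a + t • y) ∂μ = ENNReal.ofReal |(t ^ Module.finrank ℝ E)⁻¹| * ∫⁻ y, H y ∂μ := by
  have h1 : ∫⁻ y, H (a + t • y) ∂μ = ∫⁻ y, H (a + y) ∂(μ.map (fun y => t • y)) :=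
    (lintegral_map (hH.comp (measurable_const_add a)) (measurable_const_smul t)).symm
  rw [h1, Measure.map_addHaar_smul μ ht, lintegral_smul_measure, lintegral_add_left_eq_self]
  rfl

/-- Substituting `z = (1 - t) x + t y` for `y` costs the Jacobian `t⁻ⁿ`, which is unbounded as `t →
0`. One of the weights `t`, `1 - t` is at least `1/2`; substituting for the variable carrying it,
after swapping the integrals if need be, costs at most `2ⁿ`. -/
theorem lintegral_lintegral_convexComb_le {E : Type*} [NormedAddCommGroup E] [NormedSpace ℝ E]
    [MeasurableSpace E] [BorelSpace E] [FiniteDimensional ℝ E] (μ : Measure E)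
    [μ.IsAddHaarMeasure] {H : E → ℝ≥0∞} (hH : Measurable H) (D : Set E) (t : ℝ) :
    ∫⁻ x in D, ∫⁻ y in D, H ((1 - t) • x + t • y) ∂μ ∂μ ≤
      2 ^ Module.finrank ℝ E * μ D * ∫⁻ z, H z ∂μ := by
  have key : ∀ s : ℝ, 1 / 2 ≤ s → ∀ a : E, ∫⁻ y in D, H (a + s • y) ∂μ ≤
      2 ^ Module.finrank ℝ E * ∫⁻ z, H z ∂μ := by
    intro s hs a
    refine (setLIntegral_le_lintegral _ _).trans ?_
    rw [lintegral_comp_add_smul μ hH a (by linarith : s ≠ 0 )]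
    gcongr
    have h0 : (0 : ℝ) < s := by linarith
    rw [abs_of_pos (by positivity), ← inv_pow, ENNReal.ofReal_pow (by positivity)]
    gcongr
    rw [← ENNReal.ofReal_ofNat]
    apply ENNReal.ofReal_le_ofReal
    rw [inv_le_comm₀ h0 (by norm_num)]
    linarith
  have fin : ∀ s : ℝ, 1 / 2 ≤ s →
      ∫⁻ x in D, ∫⁻ y in D, H ((1 - s) • x + s • y) ∂μ ∂μ ≤
      2 ^ Module.finrank ℝ E * μ D * ∫⁻ z, H z ∂μ := by
    intro s hs
    calc _ ≤ ∫⁻ x in D, 2 ^ Module.finrank ℝ E * ∫⁻ z, H z ∂μ ∂μ :=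
          lintegral_mono fun x => key s hs _
      _ = _ := by rw [setLIntegral_const]; ring
  rcases le_total (1 / 2) t with h | h
  · exact fin t h
  · rw [lintegral_lintegral_swap]
    · have := fin (1 - t) (by linarith)
      simpa [add_comm] using this
    · apply Measurable.aemeasurable
      apply hH.comp
      fun_prop

/-- The two-point form of the Poincaré inequality on a convex set. -/
theorem lintegral_lintegral_enorm_sub_sq_le {E : Type*} [NormedAddCommGroup E] [NormedSpace ℝ E]
    [MeasurableSpace E] [BorelSpace E] [FiniteDimensional ℝ E] (μ : Measure E)
    [μ.IsAddHaarMeasure] {U D : Set E} (hU : IsOpen U) (hDU : D ⊆ U) (hD : Convex ℝ D)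
    (hDm : MeasurableSet D) {δ : ℝ≥0∞} (hδ : ∀ x ∈ D, ∀ y ∈ D, ‖y - x‖ₑ ≤ δ)
    {u : E → ℝ} (hu : ContDiffOn ℝ 1 u U) :
    ∫⁻ x in D, ∫⁻ y in D, ‖u y - u x‖ₑ ^ 2 ∂μ ∂μ ≤
      2 ^ Module.finrank ℝ E * δ ^ 2 * μ D * ∫⁻ z in D, ‖fderiv ℝ u z‖ₑ ^ 2 ∂μ := by
  have : CompleteSpace E := FiniteDimensional.complete ℝ E
  set H : E → ℝ≥0∞ := D.indicator (fun z => ‖fderiv ℝ u z‖ₑ ^ 2) with hHdef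
  have hH : Measurable H := ((measurable_fderiv ℝ u).enorm.pow_const 2).indicator hDm
  have hpt : ∀ x ∈ D, ∀ y ∈ D, ‖u y - u x‖ₑ ^ 2 ≤
      δ ^ 2 * ∫⁻ τ in Ioc (0 : ℝ) 1, H ((1 - τ) • x + τ • y) := by
    intro x hx y hy
    refine (enorm_sub_sq_le_lintegral_fderiv hU hu ((hD.segment_subset hx hy).trans hDU)).trans ?_
    have h1 := hδ x hx y hy
    gcongr ?_ ^ 2 * ?_
    · refine (setLIntegral_congr_fun measurableSet_Ioc fun τ hτ => ?_).le
      have : (1 - τ) • x + τ • y ∈ D :=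
        hD hx hy (by linarith [hτ.2]) hτ.1.le (by ring)
      simp [hHdef, this]
  have hmeas : Measurable (fun q : (E × E) × ℝ => H ((1 - q.2) • q.1.1 + q.2 • q.1.2)) := by
    apply hH.comp
    fun_prop
  calc ∫⁻ x in D, ∫⁻ y in D, ‖u y - u x‖ₑ ^ 2 ∂μ ∂μ
      ≤ ∫⁻ x in D, ∫⁻ y in D, δ ^ 2 * (∫⁻ τ in Ioc (0 : ℝ) 1, H ((1 - τ) • x + τ • y)) ∂μ ∂μ :=
        setLIntegral_mono' hDm fun x hx => setLIntegral_mono' hDm fun y hy => hpt x hx y hy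
    _ = δ ^ 2 * ∫⁻ τ in Ioc (0 : ℝ) 1,
          ∫⁻ x in D, ∫⁻ y in D, H ((1 - τ) • x + τ • y) ∂μ ∂μ := by
        have h1 : ∀ x, ∫⁻ y in D, δ ^ 2 * (∫⁻ τ in Ioc (0 : ℝ) 1, H ((1 - τ) • x + τ • y)) ∂μ =
            δ ^ 2 * ∫⁻ τ in Ioc (0 : ℝ) 1, ∫⁻ y in D, H ((1 - τ) • x + τ • y) ∂μ := by
          intro x
          rw [lintegral_const_mul, lintegral_lintegral_swap]
          · exact (hmeas.comp (g := fun q : (E × E) × ℝ => H ((1 - q.2) • q.1.1 + q.2 • q.1.2)) (f := fun q : E × ℝ => ((x, q.1), q.2))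
              (by fun_prop)).aemeasurable
          · exact Measurable.lintegral_prod_right'
              (f := fun q : E × ℝ => H ((1 - q.2) • x + q.2 • q.1))
              (hmeas.comp (g := fun q : (E × E) × ℝ => H ((1 - q.2) • q.1.1 + q.2 • q.1.2))
                (f := fun q : E × ℝ => ((x, q.1), q.2)) (by fun_prop))
        simp_rw [h1]
        have hm2 : Measurable (fun q : E × ℝ => ∫⁻ y in D, H ((1 - q.2) • q.1 + q.2 • y) ∂μ) :=
          Measurable.lintegral_prod_right'
              (f := fun q : (E × ℝ) × E => H ((1 - q.1.2) • q.1.1 + q.1.2 • q.2))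
              (hmeas.comp (g := fun q : (E × E) × ℝ => H ((1 - q.2) • q.1.1 + q.2 • q.1.2))
                (f := fun q : (E × ℝ) × E => ((q.1.1, q.2), q.1.2)) (by fun_prop))
        rw [lintegral_const_mul, lintegral_lintegral_swap]
        · exact hm2.aemeasurable
        · exact Measurable.lintegral_prod_right' hm2
    _ ≤ δ ^ 2 * ∫⁻ τ in Ioc (0 : ℝ) 1, 2 ^ Module.finrank ℝ E * μ D * ∫⁻ z, H z ∂μ := by
        refine mul_le_mul_right ?_ _
        exact lintegral_mono fun τ =>
          lintegral_lintegral_convexComb_le μ hH D τ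
    _ = _ := by
        rw [setLIntegral_const, hHdef, lintegral_indicator hDm]
        simp
        ring

/-- The Poincaré inequality on a convex set. -/
theorem exists_lintegral_enorm_sub_const_sq_le {E : Type*} [NormedAddCommGroup E]
    [NormedSpace ℝ E] [MeasurableSpace E] [BorelSpace E] [FiniteDimensional ℝ E] (μ : Measure E)
    [μ.IsAddHaarMeasure] {U D : Set E} (hU : IsOpen U) (hDU : D ⊆ U) (hD : Convex ℝ D)
    (hDm : MeasurableSet D) (hD0 : μ D ≠ 0) (hDtop : μ D ≠ ⊤)
    {δ : ℝ≥0∞} (hδ : ∀ x ∈ D, ∀ y ∈ D, ‖y - x‖ₑ ≤ δ)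
    {u : E → ℝ} (hu : ContDiffOn ℝ 1 u U) :
    ∃ c : ℝ, ∫⁻ y in D, ‖u y - c‖ₑ ^ 2 ∂μ ≤
      2 ^ Module.finrank ℝ E * δ ^ 2 * ∫⁻ z in D, ‖fderiv ℝ u z‖ₑ ^ 2 ∂μ := by
  have hm : Measurable (D.indicator u) := by
    classical
    rw [← Set.piecewise_eq_indicator]
    exact (hu.continuousOn.mono hDU).measurable_piecewise continuousOn_const hDm
  have hm2 : Measurable (fun q : E × E => ‖D.indicator u q.2 - D.indicator u q.1‖ₑ ^ 2) := by
    fun_prop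
  -- The constant is `u x` at a point `x` where the two-point integral does not exceed its average.
  -- Unlike the mean of `u`, this requires no integrability.
  obtain ⟨x, hx, h⟩ := exists_le_setLAverage hD0 hDtop
    (f := fun x => ∫⁻ y in D, ‖D.indicator u y - D.indicator u x‖ₑ ^ 2 ∂μ)
    (Measurable.lintegral_prod_right' hm2).aemeasurable
  have h1 : ∀ x ∈ D, ∫⁻ y in D, ‖D.indicator u y - D.indicator u x‖ₑ ^ 2 ∂μ =
      ∫⁻ y in D, ‖u y - u x‖ₑ ^ 2 ∂μ := fun x hx =>
    setLIntegral_congr_fun hDm fun y hy => by simp [hx, hy]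
  refine ⟨u x, ?_⟩
  rw [← h1 x hx]
  refine h.trans ?_
  rw [setLAverage_eq, setLIntegral_congr_fun hDm h1]
  refine ENNReal.div_le_of_le_mul ?_
  refine (lintegral_lintegral_enorm_sub_sq_le μ hU hDU hD hDm hδ hu).trans_eq ?_
  ring

/-- A uniform bound for the Jacobian determinant gives a comparison of integrals. -/
theorem lintegral_image_le_of_fderiv_le {E : Type*} [NormedAddCommGroup E] [NormedSpace ℝ E]
    [FiniteDimensional ℝ E] (K : ℝ) :
    ∃ C : ℝ≥0, ∀ [MeasurableSpace E] [BorelSpace E] (μ : Measure E) [μ.IsAddHaarMeasure]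
      (S : Set E) (f : E → E) (f' : E → E →L[ℝ] E) (_ : MeasurableSet S)
      (_ : ∀ x ∈ S, HasFDerivAt f (f' x) x) (_ : InjOn f S) (_ : ∀ x ∈ S, ‖f' x‖ ≤ K)
      (g : E → ℝ≥0∞), ∫⁻ x in f '' S, g x ∂μ ≤ C * ∫⁻ x in S, g (f x) ∂μ := by
  -- The determinant is continuous and the closed ball of operators is compact, so it is bounded
  -- there by a constant depending only on `E` and `K`.
  have hc : ContinuousOn (fun A : E →L[ℝ] E => A.det) (Metric.closedBall 0 K) :=
    ContinuousLinearMap.continuous_det.continuousOn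
  have : ProperSpace (E →L[ℝ] E) := FiniteDimensional.proper ℝ _
  obtain ⟨C, hC⟩ := (isCompact_closedBall (0 : E →L[ℝ] E) K).exists_bound_of_continuousOn hc
  refine ⟨C.toNNReal, fun μ _ S f f' hS hf hi hK g => ?_⟩
  rw [lintegral_image_eq_lintegral_abs_det_fderiv_mul μ hS
    (fun x hx => (hf x hx).hasFDerivWithinAt) hi, ← lintegral_const_mul' _ _ ENNReal.coe_ne_top]
  refine setLIntegral_mono' hS fun x hx => ?_
  gcongr
  exact ENNReal.ofReal_le_ofReal (hC _ (by simpa using hK x hx))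

/-! ### Longitudinal and transversal coordinates; slabs of the unit cylinder. -/

variable {d : ℕ}

/-- The transversal part `x'` of `x = (x', xₙ)`. -/
def transversal (d : ℕ) : Space d →L[ℝ] Section d :=
  LinearMap.toContinuousLinearMap
    { toFun := fun x => WithLp.toLp 2 (fun i => x (Fin.castSucc i))
      map_add' := fun _ _ => rfl
      map_smul' := fun _ _ => rfl }

/-- The longitudinal coordinate as a linear form. -/
def longitudinal (d : ℕ) : Space d →L[ℝ] ℝ := EuclideanSpace.proj (Fin.last d)

/-- The embedding `x' ↦ (x', 0)`. -/
def sectionEmbedding (d : ℕ) : Section d →L[ℝ] Space d :=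
  LinearMap.toContinuousLinearMap
    { toFun := fun x => mkPoint x 0
      map_add' := fun x y => by
        ext i; refine Fin.lastCases ?_ (fun i => ?_) i <;> simp [mkPoint]
      map_smul' := fun c x => by
        ext i; refine Fin.lastCases ?_ (fun i => ?_) i <;> simp [mkPoint] }

/-- The unit vector in the longitudinal direction. -/
def axis (d : ℕ) : Space d := EuclideanSpace.single (Fin.last d) 1

@[simp] theorem transversal_apply (x : Space d) (i : Fin d) :
    transversal d x i = x (Fin.castSucc i) := rfl

@[simp] theorem longitudinal_apply (x : Space d) : longitudinal d x = lastCoord x := rfl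

@[simp] theorem sectionEmbedding_apply (x : Section d) : sectionEmbedding d x = mkPoint x 0 := rfl

@[simp] theorem norm_axis : ‖axis d‖ = 1 := by simp [axis]

@[simp] theorem transversal_mkPoint (x : Section d) (t : ℝ) : transversal d (mkPoint x t) = x := by
  ext i; simp [mkPoint]

@[simp] theorem lastCoord_mkPoint (x : Section d) (t : ℝ) : lastCoord (mkPoint x t) = t := by
  simp [mkPoint, lastCoord]

@[simp] theorem mkPoint_transversal (x : Space d) :
    mkPoint (transversal d x) (lastCoord x) = x := by
  ext i; refine Fin.lastCases ?_ (fun i => ?_) i <;> simp [mkPoint, lastCoord]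

theorem mkPoint_eq_add (x : Section d) (t : ℝ) :
    mkPoint x t = sectionEmbedding d x + t • axis d := by
  ext i; refine Fin.lastCases ?_ (fun i => ?_) i <;> simp [mkPoint, axis]

theorem continuous_mkPoint : Continuous (fun q : Section d × ℝ => mkPoint q.1 q.2) := by
  simp_rw [mkPoint_eq_add]
  fun_prop

theorem measurable_mkPoint : Measurable (fun q : Section d × ℝ => mkPoint q.1 q.2) :=
  continuous_mkPoint.measurable

theorem continuous_lastCoord : Continuous (lastCoord : Space d → ℝ) :=
  (longitudinal d).continuous

theorem norm_sq_eq (x : Space d) : ‖x‖ ^ 2 = ‖transversal d x‖ ^ 2 + lastCoord x ^ 2 := by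
  rw [EuclideanSpace.norm_sq_eq, EuclideanSpace.norm_sq_eq, Fin.sum_univ_castSucc]
  simp [lastCoord]

theorem norm_le_add (x : Space d) : ‖x‖ ≤ ‖transversal d x‖ + |lastCoord x| := by
  refine abs_le_of_sq_le_sq' ?_ (by positivity) |>.2
  rw [norm_sq_eq, add_sq, sq_abs]
  have : 0 ≤ 2 * ‖transversal d x‖ * |lastCoord x| := by positivity
  linarith

theorem norm_transversal_le (x : Space d) : ‖transversal d x‖ ≤ ‖x‖ := by
  refine abs_le_of_sq_le_sq' ?_ (by positivity) |>.2
  rw [norm_sq_eq]; nlinarith [sq_nonneg (lastCoord x)]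

theorem norm_transversalCLM_le : ‖transversal d‖ ≤ 1 :=
  ContinuousLinearMap.opNorm_le_bound _ zero_le_one fun x => by
    simpa using norm_transversal_le x

theorem norm_sectionEmbedding_le : ‖sectionEmbedding d‖ ≤ 1 :=
  ContinuousLinearMap.opNorm_le_bound _ zero_le_one fun x => by
    have := norm_le_add (mkPoint x 0)
    simpa using this

/-- A composition of measure-preserving maps: forget the Euclidean norm, swap the factors, insert
the last coordinate, restore the norm. -/
theorem measurePreserving_mkPoint :
    MeasurePreserving (fun q : Section d × ℝ => mkPoint q.1 q.2)
      ((volume : Measure (Section d)).prod volume) volume := by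
  have h1 := (PiLp.volume_preserving_ofLp (Fin d)).prod
    (MeasurePreserving.id (volume : Measure ℝ))
  have h2 : MeasurePreserving (Prod.swap : (Fin d → ℝ) × ℝ → ℝ × (Fin d → ℝ))
    (volume.prod volume) (volume.prod volume) := Measure.measurePreserving_swap
  have h3 := (volume_preserving_piFinSuccAbove (fun _ : Fin (d + 1) => ℝ) (Fin.last d)).symm
  have h4 := PiLp.volume_preserving_toLp (Fin (d + 1))
  have h := h4.comp (h3.comp (h2.comp h1))
  have e : (fun q : Section d × ℝ => mkPoint q.1 q.2) = WithLp.toLp 2 ∘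
      (MeasurableEquiv.piFinSuccAbove (fun _ => ℝ) (Fin.last d)).symm ∘
        Prod.swap ∘ Prod.map WithLp.ofLp id := by
    funext q
    simp [mkPoint, MeasurableEquiv.piFinSuccAbove, Fin.insertNthEquiv, Fin.insertNth_last']
  rw [e]
  exact h

/-- The part of the set `A` where the longitudinal coordinate lies in `I`. -/
def part (A : Set (Space d)) (I : Set ℝ) : Set (Space d) := {x ∈ A | lastCoord x ∈ I}

theorem mem_unitCylinder_iff {y : Space d} :
    y ∈ unitCylinder d ↔ transversal d y ∈ Metric.ball (0 : Section d) 1 := by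
  rw [mem_ball_zero_iff, ← sq_lt_one_iff₀ (norm_nonneg _), EuclideanSpace.norm_sq_eq]
  simp [unitCylinder]

theorem isOpen_unitCylinder : IsOpen (unitCylinder d) := by
  have : unitCylinder d = transversal d ⁻¹' Metric.ball (0 : Section d) 1 := by
    ext y; exact mem_unitCylinder_iff
  rw [this]
  exact Metric.isOpen_ball.preimage (transversal d).continuous

theorem measurableSet_part {A : Set (Space d)} (hA : IsOpen A) {I : Set ℝ}
    (hI : MeasurableSet I) : MeasurableSet (part A I) :=
  hA.measurableSet.inter (continuous_lastCoord.measurable hI)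

theorem convex_part_unitCylinder {I : Set ℝ} (hI : Convex ℝ I) :
    Convex ℝ (part (unitCylinder d) I) := by
  have : part (unitCylinder d) I =
      (transversal d).toLinearMap ⁻¹' Metric.ball (0 : Section d) 1 ∩
        (longitudinal d).toLinearMap ⁻¹' I := by
    ext y
    simp only [part, mem_ofPred_eq, mem_unitCylinder_iff]
    rfl
  rw [this]
  exact ((convex_ball _ _).linear_preimage _).inter (hI.linear_preimage _)

theorem mkPoint_preimage_part (I : Set ℝ) :
    (fun q : Section d × ℝ => mkPoint q.1 q.2) ⁻¹' part (unitCylinder d) I =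
      Metric.ball (0 : Section d) 1 ×ˢ I := by
  ext q
  simp [part, mem_unitCylinder_iff]

theorem volume_part_unitCylinder {I : Set ℝ} (hI : MeasurableSet I) :
    volume (part (unitCylinder d) I) = volume (Metric.ball (0 : Section d) 1) * volume I := by
  rw [← measurePreserving_mkPoint.measure_preimage
    (measurableSet_part isOpen_unitCylinder hI).nullMeasurableSet, mkPoint_preimage_part,
    Measure.prod_prod]

theorem lintegral_part_unitCylinder {I : Set ℝ} (hI : MeasurableSet I) {f : Space d → ℝ≥0∞}
    (hf : AEMeasurable f (volume.restrict (part (unitCylinder d) I))) :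
    ∫⁻ y in part (unitCylinder d) I, f y =
      ∫⁻ y' in Metric.ball (0 : Section d) 1, ∫⁻ t in I, f (mkPoint y' t) := by
  have h := measurePreserving_mkPoint.restrict_preimage (s := part (unitCylinder d) I)
    (measurableSet_part (d := d) isOpen_unitCylinder hI)
  rw [mkPoint_preimage_part, ← Measure.prod_restrict] at h
  rw [← h.map_eq, lintegral_map' (by rwa [h.map_eq]) measurable_mkPoint.aemeasurable,
    lintegral_prod _ (by
      apply AEMeasurable.comp_measurable _ measurable_mkPoint
      rwa [h.map_eq])]

/-! ### Flattening the nozzle and comparing integrals with those on the cylinder. -/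

/-- `T` and `R = T⁻¹` are `C¹` maps with bounded derivatives between the nozzle and the unit
cylinder which preserve the longitudinal coordinate. -/
structure IsFlattening (Ω : Set (Space d)) (T R : Space d → Space d) (K : ℝ≥0) : Prop where
  isOpen : IsOpen Ω
  map_mem : ∀ x ∈ Ω, T x ∈ unitCylinder d
  inv_mem : ∀ y ∈ unitCylinder d, R y ∈ Ω
  left_inv : ∀ x ∈ Ω, R (T x) = x
  right_inv : ∀ y ∈ unitCylinder d, T (R y) = y
  lastCoord_map : ∀ x ∈ Ω, lastCoord (T x) = lastCoord x
  lastCoord_inv : ∀ y ∈ unitCylinder d, lastCoord (R y) = lastCoord y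
  contDiffOn_map : ContDiffOn ℝ 1 T Ω
  contDiffOn_inv : ContDiffOn ℝ 1 R (unitCylinder d)
  norm_map_le : ∀ x ∈ Ω, ‖fderiv ℝ T x‖ ≤ K
  norm_inv_le : ∀ y ∈ unitCylinder d, ‖fderiv ℝ R y‖ ≤ K

/-- Mapping each section onto the section of the same height forces `T`, and hence its inverse `R`,
to preserve the longitudinal coordinate. -/
theorem IsNozzle.exists_isFlattening {Ω : Set (Space d)} (h : IsNozzle Ω) :
    ∃ T R K, IsFlattening Ω T R K := by
  obtain ⟨ho, α, K, -, -, T, R, -, hinv, -, hsec, hT, hR⟩ := h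
  have hm : ∀ x ∈ Ω, T x ∈ unitCylinder d ∧ lastCoord (T x) = lastCoord x := by
    intro x hx
    have : T x ∈ T '' {z ∈ Ω | lastCoord z = lastCoord x} := mem_image_of_mem _ ⟨hx, rfl⟩
    rw [hsec] at this
    exact this
  have hl : ∀ x ∈ Ω, R (T x) = x := fun x hx => hinv.1 (subset_closure hx)
  have hi : ∀ y ∈ unitCylinder d, R y ∈ Ω ∧ lastCoord (R y) = lastCoord y := by
    intro y hy
    have : y ∈ {z ∈ unitCylinder d | lastCoord z = lastCoord y} := ⟨hy, rfl⟩
    rw [← hsec] at this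
    obtain ⟨x, ⟨hx, hxy⟩, rfl⟩ := this
    rw [hl x hx]
    exact ⟨hx, hxy⟩
  exact ⟨T, R, K.toNNReal, ho, fun x hx => (hm x hx).1, fun y hy => (hi y hy).1, hl,
    fun y hy => hinv.2 (subset_closure hy), fun x hx => (hm x hx).2, fun y hy => (hi y hy).2,
    hT.contDiffOn.of_le (by norm_num), hR.contDiffOn.of_le (by norm_num),
    fun x hx => (hT.norm_fderiv_le x hx).trans (Real.le_coe_toNNReal K),
    fun y hy => (hR.norm_fderiv_le y hy).trans (Real.le_coe_toNNReal K)⟩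

section Comparison

variable {Ω : Set (Space d)} {T R : Space d → Space d} {K : ℝ≥0}

theorem IsFlattening.image_part (h : IsFlattening Ω T R K) (I : Set ℝ) :
    T '' part Ω I = part (unitCylinder d) I := by
  ext y
  constructor
  · rintro ⟨x, ⟨hx, hxI⟩, rfl⟩
    exact ⟨h.map_mem x hx, by rwa [h.lastCoord_map x hx]⟩
  · rintro ⟨hy, hyI⟩
    exact ⟨R y, ⟨h.inv_mem y hy, by rwa [h.lastCoord_inv y hy]⟩, h.right_inv y hy⟩

theorem IsFlattening.image_inv_part (h : IsFlattening Ω T R K) (I : Set ℝ) :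
    R '' part (unitCylinder d) I = part Ω I := by
  ext y
  constructor
  · rintro ⟨x, ⟨hx, hxI⟩, rfl⟩
    exact ⟨h.inv_mem x hx, by rwa [h.lastCoord_inv x hx]⟩
  · rintro ⟨hy, hyI⟩
    exact ⟨T y, ⟨h.map_mem y hy, by rwa [h.lastCoord_map y hy]⟩, h.left_inv y hy⟩

theorem IsFlattening.hasFDerivAt_map (h : IsFlattening Ω T R K) {x : Space d} (hx : x ∈ Ω) :
    HasFDerivAt T (fderiv ℝ T x) x :=
  ((h.contDiffOn_map.differentiableOn one_ne_zero).differentiableAt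
    (h.isOpen.mem_nhds hx)).hasFDerivAt

theorem IsFlattening.hasFDerivAt_inv (h : IsFlattening Ω T R K) {y : Space d}
    (hy : y ∈ unitCylinder d) : HasFDerivAt R (fderiv ℝ R y) y :=
  ((h.contDiffOn_inv.differentiableOn one_ne_zero).differentiableAt
    (isOpen_unitCylinder.mem_nhds hy)).hasFDerivAt

/-- The two inequalities are changes of variables along `R` and along `T`, each with a Jacobian
bounded through `K`; slabs correspond because heights are preserved. -/
theorem IsFlattening.exists_lintegral_part_le (h : IsFlattening Ω T R K) :
    ∃ C : ℝ≥0, ∀ I : Set ℝ, MeasurableSet I → ∀ g : Space d → ℝ≥0∞,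
      ∫⁻ x in part Ω I, g x ≤ C * ∫⁻ y in part (unitCylinder d) I, g (R y) ∧
      ∫⁻ y in part (unitCylinder d) I, g (R y) ≤ C * ∫⁻ x in part Ω I, g x := by
  obtain ⟨C, hC⟩ := lintegral_image_le_of_fderiv_le (E := Space d) K
  refine ⟨C, fun I hI g => ⟨?_, ?_⟩⟩
  · have := hC volume (part (unitCylinder d) I) R (fderiv ℝ R)
      (measurableSet_part isOpen_unitCylinder hI) (fun x hx => h.hasFDerivAt_inv hx.1)
      (fun x hx y hy hxy => by rw [← h.right_inv x hx.1, hxy, h.right_inv y hy.1])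
      (fun x hx => h.norm_inv_le x hx.1) g
    rwa [h.image_inv_part] at this
  · have := hC volume (part Ω I) T (fderiv ℝ T)
      (measurableSet_part h.isOpen hI) (fun x hx => h.hasFDerivAt_map hx.1)
      (fun x hx y hy hxy => by rw [← h.left_inv x hx.1, hxy, h.left_inv y hy.1])
      (fun x hx => h.norm_map_le x hx.1) (fun y => g (R y))
    rw [h.image_part] at this
    refine this.trans_eq ?_
    congr 1
    exact setLIntegral_congr_fun (measurableSet_part h.isOpen hI) fun x hx => by
      simp only [h.left_inv x hx.1]

theorem measurableSet_crossSection (hΩ : IsOpen Ω) (t : ℝ) : MeasurableSet (crossSection Ω t) :=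
  hΩ.measurableSet.preimage (measurable_mkPoint.comp measurable_prodMk_right)

theorem hasFDerivAt_mkPoint (x : Section d) (t : ℝ) :
    HasFDerivAt (fun x => mkPoint x t) (sectionEmbedding d) x := by
  simp_rw [mkPoint_eq_add _ t]
  exact (sectionEmbedding d).hasFDerivAt.add_const _

theorem mkPoint_mem_unitCylinder {x : Section d} {t : ℝ} :
    mkPoint x t ∈ unitCylinder d ↔ x ∈ Metric.ball (0 : Section d) 1 := by
  simp [mem_unitCylinder_iff]

theorem mkPoint_transversal_of_eq {x : Space d} {t : ℝ} (h : lastCoord x = t) :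
    mkPoint (transversal d x) t = x := by
  rw [← h, mkPoint_transversal]

theorem norm_transversal_comp_le {A : Space d →L[ℝ] Space d} (hA : ‖A‖ ≤ K) :
    ‖(transversal d) ∘L A ∘L (sectionEmbedding d)‖ ≤ K := by
  calc _ ≤ ‖transversal d‖ * (‖A‖ * ‖sectionEmbedding d‖) :=
        (ContinuousLinearMap.opNorm_comp_le _ _).trans
          (mul_le_mul_of_nonneg_left (ContinuousLinearMap.opNorm_comp_le _ _) (norm_nonneg _))
    _ ≤ 1 * (K * 1) := by
        gcongr
        · exact norm_transversalCLM_le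
        · exact norm_sectionEmbedding_le
    _ = K := by ring

/-- At fixed height, `R` and `T` restrict to mutually inverse maps `r` and `s` between the ball and
the section. Their derivatives are compressions of those of `R` and `T` by two operators of norm at
most one, so they keep the bound `K`. -/
theorem IsFlattening.exists_lintegral_crossSection_le (h : IsFlattening Ω T R K) :
    ∃ C : ℝ≥0, ∀ t : ℝ, ∀ g : Space d → ℝ≥0∞,
      ∫⁻ x' in crossSection Ω t, g (mkPoint x' t) ≤
        C * ∫⁻ y' in Metric.ball (0 : Section d) 1, g (R (mkPoint y' t)) ∧
      ∫⁻ y' in Metric.ball (0 : Section d) 1, g (R (mkPoint y' t)) ≤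
        C * ∫⁻ x' in crossSection Ω t, g (mkPoint x' t) := by
  obtain ⟨C, hC⟩ := lintegral_image_le_of_fderiv_le (E := Section d) K
  refine ⟨C, fun t g => ?_⟩
  set r : Section d → Section d := fun y' => transversal d (R (mkPoint y' t)) with hr
  set s : Section d → Section d := fun x' => transversal d (T (mkPoint x' t)) with hs
  have hr1 : ∀ y' ∈ Metric.ball (0 : Section d) 1, mkPoint (r y') t = R (mkPoint y' t) := by
    intro y' hy'
    exact mkPoint_transversal_of_eq
      ((h.lastCoord_inv _ (mkPoint_mem_unitCylinder.2 hy')).trans (lastCoord_mkPoint _ _))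
  have hs1 : ∀ x' ∈ crossSection Ω t, mkPoint (s x') t = T (mkPoint x' t) := by
    intro x' hx'
    exact mkPoint_transversal_of_eq
      ((h.lastCoord_map _ hx').trans (lastCoord_mkPoint _ _))
  have hrm : ∀ y' ∈ Metric.ball (0 : Section d) 1, r y' ∈ crossSection Ω t := by
    intro y' hy'
    change mkPoint (r y') t ∈ Ω
    rw [hr1 y' hy']
    exact h.inv_mem _ (mkPoint_mem_unitCylinder.2 hy')
  have hsm : ∀ x' ∈ crossSection Ω t, s x' ∈ Metric.ball (0 : Section d) 1 := by
    intro x' hx'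
    rw [← mkPoint_mem_unitCylinder (t := t), hs1 x' hx']
    exact h.map_mem _ hx'
  have hsr : ∀ y' ∈ Metric.ball (0 : Section d) 1, s (r y') = y' := by
    intro y' hy'
    simp only [hs]
    rw [hr1 y' hy', h.right_inv _ (mkPoint_mem_unitCylinder.2 hy'), transversal_mkPoint]
  have hrs : ∀ x' ∈ crossSection Ω t, r (s x') = x' := by
    intro x' hx'
    simp only [hr]
    rw [hs1 x' hx', h.left_inv _ hx', transversal_mkPoint]
  have hrim : r '' Metric.ball (0 : Section d) 1 = crossSection Ω t := by
    ext x'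
    exact ⟨by rintro ⟨y', hy', rfl⟩; exact hrm y' hy', fun hx' => ⟨s x', hsm x' hx', hrs x' hx'⟩⟩
  have hsim : s '' crossSection Ω t = Metric.ball (0 : Section d) 1 := by
    ext x'
    exact ⟨by rintro ⟨y', hy', rfl⟩; exact hsm y' hy', fun hx' => ⟨r x', hrm x' hx', hsr x' hx'⟩⟩
  constructor
  · have := hC volume (Metric.ball (0 : Section d) 1) r
      (fun y' => (transversal d) ∘L (fderiv ℝ R (mkPoint y' t)) ∘L (sectionEmbedding d))
      measurableSet_ball
      (fun y' hy' => (transversal d).hasFDerivAt.comp y'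
        ((h.hasFDerivAt_inv (mkPoint_mem_unitCylinder.2 hy')).comp y' (hasFDerivAt_mkPoint y' t)))
      (fun x hx y hy hxy => by rw [← hsr x hx, hxy, hsr y hy])
      (fun y' hy' => norm_transversal_comp_le (h.norm_inv_le _ (mkPoint_mem_unitCylinder.2 hy')))
      (fun x' => g (mkPoint x' t))
    rw [hrim] at this
    refine this.trans_eq ?_
    congr 1
    exact setLIntegral_congr_fun measurableSet_ball fun y' hy' => by simp only [hr1 y' hy']
  · have := hC volume (crossSection Ω t) s
      (fun y' => (transversal d) ∘L (fderiv ℝ T (mkPoint y' t)) ∘L (sectionEmbedding d))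
      (measurableSet_crossSection h.isOpen t)
      (fun y' hy' => (transversal d).hasFDerivAt.comp y'
        ((h.hasFDerivAt_map hy').comp y' (hasFDerivAt_mkPoint y' t)))
      (fun x hx y hy hxy => by rw [← hrs x hx, hxy, hrs y hy])
      (fun y' hy' => norm_transversal_comp_le (h.norm_map_le _ hy'))
      (fun y' => g (R (mkPoint y' t)))
    rw [hsim] at this
    refine this.trans_eq ?_
    congr 1
    exact setLIntegral_congr_fun (measurableSet_crossSection h.isOpen t) fun x' hx' => by
      simp only [hs1 x' hx', h.left_inv _ hx']

theorem IsFlattening.contDiffOn_comp (h : IsFlattening Ω T R K) {w : Space d → ℝ}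
    (hw : ContDiff ℝ ∞ w) : ContDiffOn ℝ 1 (fun y => w (R y)) (unitCylinder d) :=
  (hw.of_le (by exact_mod_cast le_top)).comp_contDiffOn h.contDiffOn_inv

theorem enorm_gradient (w : Space d → ℝ) (x : Space d) : ‖gradient w x‖ₑ = ‖fderiv ℝ w x‖ₑ := by
  simp [gradient, enorm_eq_nnnorm]

theorem IsFlattening.enorm_fderiv_comp_le (h : IsFlattening Ω T R K) {w : Space d → ℝ}
    (hw : ContDiff ℝ ∞ w) {y : Space d} (hy : y ∈ unitCylinder d) :
    ‖fderiv ℝ (fun y => w (R y)) y‖ₑ ^ 2 ≤ K ^ 2 * ‖gradient w (R y)‖ₑ ^ 2 := by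
  have h1 : DifferentiableAt ℝ w (R y) := (hw.differentiable (by simp)).differentiableAt
  have h2 := (h1.hasFDerivAt.comp y (h.hasFDerivAt_inv hy)).fderiv
  change fderiv ℝ (fun y => w (R y)) y = _ at h2
  rw [h2, enorm_gradient, ← mul_pow, mul_comm]
  have h3 : ‖fderiv ℝ R y‖₊ ≤ K := h.norm_inv_le y hy
  have h4 : ‖(fderiv ℝ w (R y)).comp (fderiv ℝ R y)‖₊ ≤
    ‖fderiv ℝ w (R y)‖₊ * ‖fderiv ℝ R y‖₊ := ContinuousLinearMap.opNorm_comp_le _ _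
  have h5 : ‖(fderiv ℝ w (R y)).comp (fderiv ℝ R y)‖₊ ≤ ‖fderiv ℝ w (R y)‖₊ * K :=
    h4.trans (mul_le_mul_right h3 _)
  gcongr
  simp only [enorm_eq_nnnorm]
  exact_mod_cast h5

end Comparison

/-! ### Approximating constants on the two end layers of a slab. -/

theorem enorm_add_sq_le {F : Type*} [NormedAddCommGroup F] (a b : F) :
    ‖a + b‖ₑ ^ 2 ≤ 2 * ‖a‖ₑ ^ 2 + 2 * ‖b‖ₑ ^ 2 := by
  have h : ‖a + b‖₊ ^ 2 ≤ 2 * ‖a‖₊ ^ 2 + 2 * ‖b‖₊ ^ 2 := by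
    rw [← NNReal.coe_le_coe]
    push_cast
    have h1 := norm_add_le a b
    have h2 : ‖a + b‖ ^ 2 ≤ (‖a‖ + ‖b‖) ^ 2 := by gcongr
    nlinarith [sq_nonneg (‖a‖ - ‖b‖)]
  simp only [enorm_eq_nnnorm]
  exact_mod_cast h

theorem enorm_sub_sq_le_three (a b c e : ℝ) :
    ‖a - b‖ₑ ^ 2 ≤ 3 * (‖c - a‖ₑ ^ 2 + ‖e - c‖ₑ ^ 2 + ‖e - b‖ₑ ^ 2) := by
  have h : ‖a - b‖₊ ^ 2 ≤ 3 * (‖c - a‖₊ ^ 2 + ‖e - c‖₊ ^ 2 + ‖e - b‖₊ ^ 2) := by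
    rw [← NNReal.coe_le_coe]
    push_cast
    simp only [Real.norm_eq_abs, sq_abs]
    nlinarith [sq_nonneg ((c - a) - (e - c)), sq_nonneg ((c - a) + (e - b)),
      sq_nonneg ((e - c) + (e - b))]
  simp only [enorm_eq_nnnorm]
  exact_mod_cast h

theorem lintegral_add_sq_le {α F : Type*} [MeasurableSpace α] [NormedAddCommGroup F]
    (μ : Measure α) {f g : α → F} (hf : AEStronglyMeasurable f μ) :
    ∫⁻ x, ‖f x + g x‖ₑ ^ 2 ∂μ ≤ 2 * ∫⁻ x, ‖f x‖ₑ ^ 2 ∂μ + 2 * ∫⁻ x, ‖g x‖ₑ ^ 2 ∂μ := by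
  have h2 : AEMeasurable (fun x => 2 * ‖f x‖ₑ ^ 2) μ := (hf.enorm.pow_const 2).const_mul 2
  calc _ ≤ ∫⁻ x, 2 * ‖f x‖ₑ ^ 2 + 2 * ‖g x‖ₑ ^ 2 ∂μ :=
        lintegral_mono fun x => enorm_add_sq_le _ _
    _ = _ := by
        rw [lintegral_add_left' h2, lintegral_const_mul' _ _ (by simp),
          lintegral_const_mul' _ _ (by simp)]

/-- Constants with a Poincaré inequality on two sets `D₁` and `D₂` differ little if the two sets
are contained in a set on which the two-point Poincaré inequality holds. -/
theorem enorm_sub_sq_mul_le {E : Type*} [MeasurableSpace E] (μ : Measure E) [SFinite μ]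
    {D₁ D₂ D : Set E} (h1 : D₁ ⊆ D) (h2 : D₂ ⊆ D)
    {u : E → ℝ} (hu : AEMeasurable u (μ.restrict D)) (c₁ c₂ : ℝ) :
    μ D₁ * μ D₂ * ‖c₁ - c₂‖ₑ ^ 2 ≤
      3 * (μ D₂ * ∫⁻ x in D₁, ‖u x - c₁‖ₑ ^ 2 ∂μ +
        ∫⁻ x in D, ∫⁻ y in D, ‖u y - u x‖ₑ ^ 2 ∂μ ∂μ +
        μ D₁ * ∫⁻ y in D₂, ‖u y - c₂‖ₑ ^ 2 ∂μ) := by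
  have hu1 : AEMeasurable u (μ.restrict D₁) := hu.mono_set h1
  have hu2 : AEMeasurable u (μ.restrict D₂) := hu.mono_set h2
  have hin : ∀ x, ∫⁻ y in D₂, 3 * (‖u x - c₁‖ₑ ^ 2 + ‖u y - u x‖ₑ ^ 2 + ‖u y - c₂‖ₑ ^ 2) ∂μ =
      3 * (μ D₂ * ‖u x - c₁‖ₑ ^ 2 + ∫⁻ y in D₂, ‖u y - u x‖ₑ ^ 2 ∂μ +
        ∫⁻ y in D₂, ‖u y - c₂‖ₑ ^ 2 ∂μ) := by
    intro x
    have ha : AEMeasurable (fun y => ‖u y - u x‖ₑ ^ 2) (μ.restrict D₂) :=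
      (hu2.sub_const _).enorm.pow_const 2
    have hb : AEMeasurable (fun y => ‖u x - c₁‖ₑ ^ 2 + ‖u y - u x‖ₑ ^ 2) (μ.restrict D₂) :=
      aemeasurable_const.add ha
    rw [lintegral_const_mul' _ _ (by simp), lintegral_add_left' hb,
      lintegral_add_left' aemeasurable_const, setLIntegral_const, mul_comm (μ D₂)]
  -- Integrate the constant over `D₁ × D₂` and pass from `c₁` to `c₂` through `u x` and `u y`.
  calc μ D₁ * μ D₂ * ‖c₁ - c₂‖ₑ ^ 2 = ∫⁻ _ in D₁, ∫⁻ _ in D₂, ‖c₁ - c₂‖ₑ ^ 2 ∂μ ∂μ := by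
        simp only [setLIntegral_const]; ring
    _ ≤ ∫⁻ x in D₁, ∫⁻ y in D₂,
          3 * (‖u x - c₁‖ₑ ^ 2 + ‖u y - u x‖ₑ ^ 2 + ‖u y - c₂‖ₑ ^ 2) ∂μ ∂μ :=
        lintegral_mono fun x => lintegral_mono fun y => enorm_sub_sq_le_three _ _ _ _
    _ = 3 * (μ D₂ * ∫⁻ x in D₁, ‖u x - c₁‖ₑ ^ 2 ∂μ +
        ∫⁻ x in D₁, ∫⁻ y in D₂, ‖u y - u x‖ₑ ^ 2 ∂μ ∂μ +
        μ D₁ * ∫⁻ y in D₂, ‖u y - c₂‖ₑ ^ 2 ∂μ) := by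
        simp_rw [hin]
        have ha : AEMeasurable (fun x => ‖u x - c₁‖ₑ ^ 2) (μ.restrict D₁) :=
          (hu1.sub_const _).enorm.pow_const 2
        have hb : AEMeasurable (fun x => ∫⁻ y in D₂, ‖u y - u x‖ₑ ^ 2 ∂μ) (μ.restrict D₁) :=
          AEMeasurable.lintegral_prod_right' (f := fun q : E × E => ‖u q.2 - u q.1‖ₑ ^ 2)
            ((hu2.comp_snd.sub hu1.comp_fst).enorm.pow_const 2)
        rw [lintegral_const_mul' _ _ (by simp), lintegral_add_right' _ aemeasurable_const,
          lintegral_add_right' _ hb, lintegral_const_mul'' _ ha, setLIntegral_const,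
          mul_comm (μ D₁)]
    _ ≤ _ := by
        gcongr

section

variable {Ω : Set (Space d)} {T R : Space d → Space d} {K : ℝ≥0}

theorem enorm_sub_le_of_mem_part {a b : ℝ} {I : Set ℝ} (hI : I ⊆ Icc a b)
    {x y : Space d} (hx : x ∈ part (unitCylinder d) I) (hy : y ∈ part (unitCylinder d) I) :
    ‖y - x‖ₑ ≤ ENNReal.ofReal (b - a + 2) := by
  rw [← ofReal_norm]
  apply ENNReal.ofReal_le_ofReal
  have h1 := hI hx.2
  have h2 := hI hy.2
  have h3 := mem_ball_zero_iff.1 (mem_unitCylinder_iff.1 hx.1)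
  have h4 := mem_ball_zero_iff.1 (mem_unitCylinder_iff.1 hy.1)
  have h5 := norm_sub_le (transversal d y) (transversal d x)
  have h6 := norm_le_add (y - x)
  have h7 : |lastCoord (y - x)| ≤ b - a := by
    have : lastCoord (y - x) = lastCoord y - lastCoord x := rfl
    rw [this, abs_le]
    constructor <;> linarith [h1.1, h1.2, h2.1, h2.2]
  rw [map_sub] at h6
  linarith

theorem IsFlattening.lintegral_fderiv_comp_le (h : IsFlattening Ω T R K) {C : ℝ≥0}
    {I : Set ℝ} (hI : MeasurableSet I)
    (hC : ∀ g : Space d → ℝ≥0∞,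
      ∫⁻ y in part (unitCylinder d) I, g (R y) ≤ C * ∫⁻ x in part Ω I, g x)
    {w : Space d → ℝ} (hw : ContDiff ℝ ∞ w) :
    ∫⁻ y in part (unitCylinder d) I, ‖fderiv ℝ (fun y => w (R y)) y‖ₑ ^ 2 ≤
      K ^ 2 * C * ∫⁻ x in part Ω I, ‖gradient w x‖ₑ ^ 2 := by
  calc _ ≤ ∫⁻ y in part (unitCylinder d) I, K ^ 2 * ‖gradient w (R y)‖ₑ ^ 2 :=
        setLIntegral_mono' (measurableSet_part isOpen_unitCylinder hI)
          fun y hy => h.enorm_fderiv_comp_le hw hy.1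
    _ = K ^ 2 * ∫⁻ y in part (unitCylinder d) I, ‖gradient w (R y)‖ₑ ^ 2 :=
        lintegral_const_mul' _ _ (by simp)
    _ ≤ _ := by
        rw [mul_assoc]
        gcongr
        exact hC fun x => ‖gradient w x‖ₑ ^ 2

/-- The layer at the lower end of the slab of half-width `r + 1` around height `z`. -/
def lowerLayer (z r : ℝ) : Set ℝ := Ioc (z - r - 1) (z - r)

/-- The layer at the upper end of the slab of half-width `r + 1` around height `z`. -/
def upperLayer (z r : ℝ) : Set ℝ := Ico (z + r) (z + r + 1)

/-- The flattened layers have height one, hence a fixed volume `β` and diameter at most 3, so their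
Poincaré constants do not depend on `z` and `r`. Only `c₁ - c₂` sees the long slab: squared diameter
times volume grows like `r² · r`. -/
theorem IsFlattening.exists_layer_constants (h : IsFlattening Ω T R K) :
    ∃ C : ℝ≥0, ∀ (z r : ℝ), 1 ≤ r → ∀ w : Space d → ℝ, ContDiff ℝ ∞ w → ∃ c₁ c₂ : ℝ,
      ∫⁻ x in part Ω (lowerLayer z r), ‖w x - c₁‖ₑ ^ 2 ≤
        C * ∫⁻ x in part Ω (lowerLayer z r), ‖gradient w x‖ₑ ^ 2 ∧
      ∫⁻ x in part Ω (upperLayer z r), ‖w x - c₂‖ₑ ^ 2 ≤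
        C * ∫⁻ x in part Ω (upperLayer z r), ‖gradient w x‖ₑ ^ 2 ∧
      ‖c₁ - c₂‖ₑ ^ 2 ≤ C * ENNReal.ofReal (r ^ 3) *
        ∫⁻ x in part Ω (Ioo (z - (r + 1)) (z + (r + 1))), ‖gradient w x‖ₑ ^ 2 := by
  obtain ⟨C, hC⟩ := h.exists_lintegral_part_le
  set N : ℝ≥0 := 2 ^ (d + 1) with hN
  set β : ℝ≥0∞ := volume (Metric.ball (0 : Section d) 1) with hβ
  have hβ0 : β ≠ 0 := (Metric.measure_ball_pos _ _ one_pos).ne'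
  have hβt : β ≠ ⊤ := measure_ball_lt_top.ne
  -- `162 = 9 + 144 + 9`: squared diameter bound `3²` for each layer, and `(2r + 4)² (2r + 2) ≤ 144
  -- r³` for the slab.
  set κ : ℝ≥0 := 3 * β.toNNReal⁻¹ * N * 162 * (K ^ 2 * C) with hκ
  refine ⟨max (C * (N * 9 * (K ^ 2 * C))) κ, fun z r hr w hw => ?_⟩
  set u : Space d → ℝ := fun y => w (R y) with hu
  have hu1 : ContDiffOn ℝ 1 u (unitCylinder d) := h.contDiffOn_comp hw
  have hfin : Module.finrank ℝ (Space d) = d + 1 := by simp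
  set J : Set ℝ := Ioo (z - (r + 1)) (z + (r + 1)) with hJ
  have hlm : MeasurableSet (lowerLayer z r) := measurableSet_Ioc
  have hum : MeasurableSet (upperLayer z r) := measurableSet_Ico
  have hJm : MeasurableSet J := measurableSet_Ioo
  have hlJ : lowerLayer z r ⊆ J := fun t ht => ⟨by linarith [ht.1], by linarith [ht.2]⟩
  have huJ : upperLayer z r ⊆ J := fun t ht => ⟨by linarith [ht.1], by linarith [ht.2]⟩
  have hvl : volume (part (unitCylinder d) (lowerLayer z r)) = β := by
    rw [volume_part_unitCylinder hlm, lowerLayer, Real.volume_Ioc]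
    simp [hβ]
  have hvu : volume (part (unitCylinder d) (upperLayer z r)) = β := by
    rw [volume_part_unitCylinder hum, upperLayer, Real.volume_Ico]
    simp [hβ]
  have hvJ : volume (part (unitCylinder d) J) = β * ENNReal.ofReal (2 * r + 2) := by
    rw [volume_part_unitCylinder hJm, Real.volume_Ioo]
    congr 2; ring
  obtain ⟨c₁, hc₁⟩ := exists_lintegral_enorm_sub_const_sq_le (volume : Measure (Space d))
    (D := part (unitCylinder d) (lowerLayer z r)) (δ := ENNReal.ofReal 3) isOpen_unitCylinder
    (fun x hx => hx.1) (convex_part_unitCylinder (convex_Ioc _ _))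
    (measurableSet_part isOpen_unitCylinder hlm) (hvl ▸ hβ0) (hvl ▸ hβt)
    (fun x hx y hy => by
      convert enorm_sub_le_of_mem_part (a := z - r - 1) (b := z - r)
        Ioc_subset_Icc_self hx hy using 2
      ring) hu1
  obtain ⟨c₂, hc₂⟩ := exists_lintegral_enorm_sub_const_sq_le (volume : Measure (Space d))
    (D := part (unitCylinder d) (upperLayer z r)) (δ := ENNReal.ofReal 3) isOpen_unitCylinder
    (fun x hx => hx.1) (convex_part_unitCylinder (convex_Ico _ _))
    (measurableSet_part isOpen_unitCylinder hum) (hvu ▸ hβ0) (hvu ▸ hβt)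
    (fun x hx y hy => by
      convert enorm_sub_le_of_mem_part (a := z + r) (b := z + r + 1)
        Ico_subset_Icc_self hx hy using 2
      ring) hu1
  have hcJ := lintegral_lintegral_enorm_sub_sq_le (volume : Measure (Space d))
    (D := part (unitCylinder d) J) (δ := ENNReal.ofReal (2 * r + 4)) isOpen_unitCylinder
    (fun x hx => hx.1) (convex_part_unitCylinder (convex_Ioo _ _))
    (measurableSet_part isOpen_unitCylinder hJm)
    (fun x hx y hy => by
      convert enorm_sub_le_of_mem_part (a := z - (r + 1)) (b := z + (r + 1))
        Ioo_subset_Icc_self hx hy using 2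
      ring) hu1
  rw [hfin] at hc₁ hc₂ hcJ
  have h9 : ENNReal.ofReal 3 ^ 2 = 9 := by
    rw [← ENNReal.ofReal_pow (by norm_num)]; norm_num
  have h2N : (2 : ℝ≥0∞) ^ (d + 1) = N := by simp [hN]
  rw [h9, h2N] at hc₁ hc₂
  rw [h2N, hvJ] at hcJ
  have transfer : ∀ I : Set ℝ, MeasurableSet I → ∀ c : ℝ,
      ∫⁻ y in part (unitCylinder d) I, ‖u y - c‖ₑ ^ 2 ≤
        N * 9 * ∫⁻ y in part (unitCylinder d) I, ‖fderiv ℝ u y‖ₑ ^ 2 →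
      ∫⁻ x in part Ω I, ‖w x - c‖ₑ ^ 2 ≤ (max (C * (N * 9 * (K ^ 2 * C))) κ : ℝ≥0) *
        ∫⁻ x in part Ω I, ‖gradient w x‖ₑ ^ 2 := by
    intro I hI c hc
    calc ∫⁻ x in part Ω I, ‖w x - c‖ₑ ^ 2
        ≤ C * ∫⁻ y in part (unitCylinder d) I, ‖u y - c‖ₑ ^ 2 :=
          (hC I hI fun x => ‖w x - c‖ₑ ^ 2).1
      _ ≤ C * (N * 9 * (K ^ 2 * C * ∫⁻ x in part Ω I, ‖gradient w x‖ₑ ^ 2)) := by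
          gcongr
          refine hc.trans ?_
          gcongr
          exact h.lintegral_fderiv_comp_le hI (fun g => (hC I hI g).2) hw
      _ = ((C * (N * 9 * (K ^ 2 * C)) : ℝ≥0) : ℝ≥0∞) *
            ∫⁻ x in part Ω I, ‖gradient w x‖ₑ ^ 2 := by
          push_cast; ring
      _ ≤ _ := by
          gcongr
          exact le_max_left _ _
  refine ⟨c₁, c₂, transfer _ hlm c₁ hc₁, transfer _ hum c₂ hc₂, ?_⟩
  set G := ∫⁻ y in part (unitCylinder d) J, ‖fderiv ℝ u y‖ₑ ^ 2 with hG
  have hG1 : ∫⁻ y in part (unitCylinder d) (lowerLayer z r), ‖fderiv ℝ u y‖ₑ ^ 2 ≤ G :=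
    lintegral_mono_set fun x hx => ⟨hx.1, hlJ hx.2⟩
  have hG2 : ∫⁻ y in part (unitCylinder d) (upperLayer z r), ‖fderiv ℝ u y‖ₑ ^ 2 ≤ G :=
    lintegral_mono_set fun x hx => ⟨hx.1, huJ hx.2⟩
  have hum : AEMeasurable u (volume.restrict (part (unitCylinder d) J)) :=
    (hu1.continuousOn.mono fun x hx => hx.1).aemeasurable
      (measurableSet_part isOpen_unitCylinder hJm)
  have key := enorm_sub_sq_mul_le (volume : Measure (Space d))
    (D₁ := part (unitCylinder d) (lowerLayer z r)) (D₂ := part (unitCylinder d) (upperLayer z r))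
    (D := part (unitCylinder d) J) (fun x hx => ⟨hx.1, hlJ hx.2⟩)
    (fun x hx => ⟨hx.1, huJ hx.2⟩) hum c₁ c₂
  rw [hvl, hvu] at key
  have hr1 : (1 : ℝ≥0∞) ≤ ENNReal.ofReal (r ^ 3) := by
    rw [← ENNReal.ofReal_one]
    exact ENNReal.ofReal_le_ofReal (one_le_pow₀ hr)
  have hr2 : ENNReal.ofReal (2 * r + 4) ^ 2 * ENNReal.ofReal (2 * r + 2) ≤
      144 * ENNReal.ofReal (r ^ 3) := by
    rw [← ENNReal.ofReal_pow (by linarith), ← ENNReal.ofReal_mul (by positivity),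
      ← ENNReal.ofReal_ofNat, ← ENNReal.ofReal_mul (by norm_num)]
    apply ENNReal.ofReal_le_ofReal
    calc (2 * r + 4) ^ 2 * (2 * r + 2) ≤ (6 * r) ^ 2 * (4 * r) := by
          gcongr <;> linarith
      _ = 144 * r ^ 3 := by ring
  have hbound : β * (β * ‖c₁ - c₂‖ₑ ^ 2) ≤
      β * (3 * (N * 162 * ENNReal.ofReal (r ^ 3) * G)) := by
    calc β * (β * ‖c₁ - c₂‖ₑ ^ 2) = β * β * ‖c₁ - c₂‖ₑ ^ 2 := by ring
      _ ≤ _ := key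
      _ ≤ 3 * (β * (N * 9 * (1 * G)) + N * ENNReal.ofReal (2 * r + 4) ^ 2 *
          (β * ENNReal.ofReal (2 * r + 2)) * G + β * (N * 9 * (1 * G))) := by
          gcongr
          · refine hc₁.trans ?_
            rw [one_mul]; gcongr
          · refine hc₂.trans ?_
            rw [one_mul]; gcongr
      _ = 3 * (β * (N * 9 * (1 * G)) + N * (ENNReal.ofReal (2 * r + 4) ^ 2 *
          ENNReal.ofReal (2 * r + 2)) * β * G + β * (N * 9 * (1 * G))) := by ring
      _ ≤ 3 * (β * (N * 9 * (ENNReal.ofReal (r ^ 3) * G)) + N * (144 * ENNReal.ofReal (r ^ 3)) *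
          β * G + β * (N * 9 * (ENNReal.ofReal (r ^ 3) * G))) := by
          gcongr
      _ = _ := by ring
  have hb2 := (ENNReal.mul_le_mul_iff_right hβ0 hβt).1 hbound
  calc ‖c₁ - c₂‖ₑ ^ 2 = β⁻¹ * (β * ‖c₁ - c₂‖ₑ ^ 2) := by
        rw [← mul_assoc, ENNReal.inv_mul_cancel hβ0 hβt, one_mul]
    _ ≤ β⁻¹ * (3 * (N * 162 * ENNReal.ofReal (r ^ 3) *
          (K ^ 2 * C * ∫⁻ x in part Ω J, ‖gradient w x‖ₑ ^ 2))) := by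
        refine mul_le_mul_right (hb2.trans ?_) _
        gcongr
        exact h.lintegral_fderiv_comp_le hJm (fun g => (hC J hJm g).2) hw
    _ = (κ : ℝ≥0∞) * ENNReal.ofReal (r ^ 3) * ∫⁻ x in part Ω J, ‖gradient w x‖ₑ ^ 2 := by
        have : ((β.toNNReal⁻¹ : ℝ≥0) : ℝ≥0∞) = β⁻¹ := by
          rw [ENNReal.coe_inv (by simp [ENNReal.toNNReal_eq_zero_iff, hβ0, hβt]),
            ENNReal.coe_toNNReal hβt]
        rw [hκ]
        push_cast
        rw [this]
        ring
    _ ≤ _ := by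
        gcongr
        exact le_max_right _ _

end

/-! ### Uniform volume bounds and the trace inequality. -/

variable {Ω : Set (Space d)} {T R : Space d → Space d} {K : ℝ≥0}

theorem eLpNorm_two_sq {α F : Type*} [MeasurableSpace α] [NormedAddCommGroup F] (μ : Measure α)
    (f : α → F) : eLpNorm f 2 μ ^ 2 = ∫⁻ x, ‖f x‖ₑ ^ 2 ∂μ := by
  rw [eLpNorm_eq_lintegral_rpow_enorm_toReal (by norm_num) (by norm_num), ← ENNReal.rpow_natCast,
    ← ENNReal.rpow_mul]
  simp

theorem truncated_eq_part (Ω : Set (Space d)) (L : ℝ) : truncated Ω L = part Ω (Ioo (-L) L) := by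
  ext x
  simp [truncated, part, abs_lt]

theorem slab_eq_part (Ω : Set (Space d)) (x₀ : Space d) (r : ℝ) :
    slab Ω x₀ r = part Ω (Ioo (lastCoord x₀ - r) (lastCoord x₀ + r)) := by
  ext x
  simp only [slab, part, abs_lt, mem_ofPred_eq, mem_Ioo]
  constructor <;> rintro ⟨h1, h2, h3⟩ <;> exact ⟨h1, by linarith, by linarith⟩

theorem IsFlattening.volume_part_lt_top (h : IsFlattening Ω T R K) {I : Set ℝ}
    (hI : MeasurableSet I) (hIt : volume I ≠ ⊤) : volume (part Ω I) < ⊤ := by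
  obtain ⟨C, hC⟩ := h.exists_lintegral_part_le
  have h1 := (hC I hI fun _ => 1).1
  rw [setLIntegral_one, setLIntegral_one, volume_part_unitCylinder hI] at h1
  exact h1.trans_lt (ENNReal.mul_lt_top ENNReal.coe_lt_top
    (ENNReal.mul_lt_top measure_ball_lt_top (lt_top_iff_ne_top.2 hIt)))

theorem IsFlattening.exists_le_volume_part (h : IsFlattening Ω T R K) :
    ∃ c : ℝ, 0 < c ∧ ∀ a b : ℝ, a ≤ b → c * (b - a) ≤ volume.real (part Ω (Ioo a b)) := by
  obtain ⟨C, hC⟩ := h.exists_lintegral_part_le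
  have hβ : 0 < volume.real (Metric.ball (0 : Section d) 1) :=
    ENNReal.toReal_pos (Metric.measure_ball_pos _ _ one_pos).ne' measure_ball_lt_top.ne
  have hC0 : 0 < (C : ℝ) + 1 := by positivity
  -- `C + 1` replaces `C` so that the denominator is visibly positive.
  refine ⟨volume.real (Metric.ball (0 : Section d) 1) / (C + 1), by positivity,
    fun a b hab => ?_⟩
  have h1 := (hC (Ioo a b) measurableSet_Ioo fun _ => 1).2
  rw [setLIntegral_one, setLIntegral_one, volume_part_unitCylinder measurableSet_Ioo] at h1
  have h2 := ENNReal.toReal_mono (ENNReal.mul_ne_top ENNReal.coe_ne_top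
    (h.volume_part_lt_top measurableSet_Ioo (by simp)).ne) h1
  rw [ENNReal.toReal_mul, ENNReal.toReal_mul, Real.volume_Ioo,
    ENNReal.toReal_ofReal (by linarith)] at h2
  rw [div_mul_eq_mul_div, div_le_iff₀ hC0]
  refine h2.trans ?_
  rw [ENNReal.coe_toReal, mul_comm]
  have : 0 ≤ volume.real (part Ω (Ioo a b)) := measureReal_nonneg
  simp only [Measure.real] at this ⊢
  nlinarith

theorem IsFlattening.volume_crossSection_lt_top (h : IsFlattening Ω T R K) (t : ℝ) :
    volume (crossSection Ω t) < ⊤ := by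
  obtain ⟨C, hC⟩ := h.exists_lintegral_crossSection_le
  have h1 := (hC t fun _ => 1).1
  rw [setLIntegral_one, setLIntegral_one] at h1
  exact h1.trans_lt (ENNReal.mul_lt_top ENNReal.coe_lt_top measure_ball_lt_top)

theorem IsFlattening.exists_le_volume_crossSection (h : IsFlattening Ω T R K) :
    ∃ c : ℝ, 0 < c ∧ ∀ t : ℝ, c ≤ volume.real (crossSection Ω t) := by
  obtain ⟨C, hC⟩ := h.exists_lintegral_crossSection_le
  have hβ : 0 < volume.real (Metric.ball (0 : Section d) 1) :=
    ENNReal.toReal_pos (Metric.measure_ball_pos _ _ one_pos).ne' measure_ball_lt_top.ne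
  have hC0 : 0 < (C : ℝ) + 1 := by positivity
  refine ⟨volume.real (Metric.ball (0 : Section d) 1) / (C + 1), by positivity, fun t => ?_⟩
  have h1 := (hC t fun _ => 1).2
  rw [setLIntegral_one, setLIntegral_one] at h1
  have h2 := ENNReal.toReal_mono (ENNReal.mul_ne_top ENNReal.coe_ne_top
    (h.volume_crossSection_lt_top t).ne) h1
  rw [ENNReal.toReal_mul] at h2
  rw [div_le_iff₀ hC0]
  refine h2.trans ?_
  rw [ENNReal.coe_toReal, mul_comm]
  have : 0 ≤ volume.real (crossSection Ω t) := measureReal_nonneg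
  simp only [Measure.real] at this ⊢
  nlinarith

theorem lintegral_Ioc_comp_line (f : ℝ → ℝ≥0∞) (hf : Measurable f) {L : ℝ} (hL : 0 < L) :
    ENNReal.ofReal (2 * L) * ∫⁻ τ in Ioc (0 : ℝ) 1, f (-L + τ * (2 * L)) =
      ∫⁻ t in Ioo (-L) L, f t := by
  have h := lintegral_comp_add_smul (volume : Measure ℝ) (hf.indicator measurableSet_Ioc)
    (H := (Ioc (-L) L).indicator f) (-L) (t := 2 * L) (by positivity)
  rw [lintegral_indicator measurableSet_Ioc] at h
  have h2 : ∀ τ, (Ioc (-L) L).indicator f (-L + (2 * L) • τ) =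
      (Ioc (0 : ℝ) 1).indicator (fun τ => f (-L + τ * (2 * L))) τ := by
    intro τ
    have : -L + (2 * L) • τ ∈ Ioc (-L) L ↔ τ ∈ Ioc (0 : ℝ) 1 := by
      simp only [mem_Ioc, smul_eq_mul]
      constructor
      · rintro ⟨h1, h2⟩
        constructor <;> nlinarith
      · rintro ⟨h1, h2⟩
        constructor <;> nlinarith
    by_cases hτ : τ ∈ Ioc (0 : ℝ) 1
    · rw [indicator_of_mem hτ, indicator_of_mem (this.2 hτ), smul_eq_mul, mul_comm]
    · rw [indicator_of_notMem hτ, indicator_of_notMem (mt this.1 hτ)]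
  simp_rw [h2] at h
  rw [lintegral_indicator measurableSet_Ioc] at h
  rw [h, ← mul_assoc, Module.finrank_self, pow_one, ← ENNReal.ofReal_mul (by positivity),
    abs_of_pos (by positivity), mul_inv_cancel₀ (by positivity), ENNReal.ofReal_one, one_mul,
    Measure.restrict_congr_set Ioo_ae_eq_Ioc]

/-- In the flattened picture the two ends are joined by vertical segments inside the cylinder; the
one-dimensional estimate along them is integrated over the ball. -/
theorem IsFlattening.exists_trace_le (h : IsFlattening Ω T R K) :
    ∃ C : ℝ≥0, ∀ L : ℝ, 0 < L → ∀ w : Space d → ℝ, ContDiff ℝ ∞ w →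
      ∫⁻ x' in crossSection Ω L, ‖w (mkPoint x' L)‖ₑ ^ 2 ≤
        C * ((∫⁻ x' in crossSection Ω (-L), ‖w (mkPoint x' (-L))‖ₑ ^ 2) +
          ENNReal.ofReal L * ∫⁻ x in part Ω (Ioo (-L) L), ‖gradient w x‖ₑ ^ 2) := by
  obtain ⟨C₁, hC₁⟩ := h.exists_lintegral_part_le
  obtain ⟨C₂, hC₂⟩ := h.exists_lintegral_crossSection_le
  refine ⟨max (C₂ * 2 * C₂) (C₂ * 4 * (K ^ 2 * C₁)), fun L hL w hw => ?_⟩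
  set u : Space d → ℝ := fun y => w (R y) with hu
  have hu1 : ContDiffOn ℝ 1 u (unitCylinder d) := h.contDiffOn_comp hw
  have hDm : Measurable fun y => ‖fderiv ℝ u y‖ₑ ^ 2 :=
    (measurable_fderiv ℝ u).enorm.pow_const 2
  have hpt : ∀ y' ∈ Metric.ball (0 : Section d) 1,
      ‖u (mkPoint y' L) - u (mkPoint y' (-L))‖ₑ ^ 2 ≤
        ENNReal.ofReal (2 * L) * ∫⁻ t in Ioo (-L) L, ‖fderiv ℝ u (mkPoint y' t)‖ₑ ^ 2 := by
    intro y' hy'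
    have h1 := enorm_sub_sq_le_lintegral_fderiv isOpen_unitCylinder hu1
      (x := mkPoint y' (-L)) (y := mkPoint y' L) (by
        refine ((convex_part_unitCylinder convex_univ).segment_subset
          ⟨mkPoint_mem_unitCylinder.2 hy', mem_univ _⟩
          ⟨mkPoint_mem_unitCylinder.2 hy', mem_univ _⟩).trans fun x hx => hx.1)
    refine h1.trans_eq ?_
    have h2 : ‖mkPoint y' L - mkPoint y' (-L)‖ₑ = ENNReal.ofReal (2 * L) := by
      rw [mkPoint_eq_add, mkPoint_eq_add y' (-L), add_sub_add_left_eq_sub, ← sub_smul,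
        ← ofReal_norm, norm_smul, norm_axis, mul_one, Real.norm_eq_abs,
        abs_of_pos (by linarith)]
      congr 1; ring
    have h3 := lintegral_Ioc_comp_line (fun t => ‖fderiv ℝ u (mkPoint y' t)‖ₑ ^ 2) (hDm.comp
      (measurable_mkPoint.comp measurable_prodMk_left)) hL
    -- Of the two factors `2L` from the squared length of the segment, one is used up in rescaling
    -- the parameter interval to `(-L, L)`.
    rw [h2, ← h3, ← mul_assoc, ← sq]
    congr 2
    funext τ
    have : (1 - τ) • mkPoint y' (-L) + τ • mkPoint y' L = mkPoint y' (-L + τ * (2 * L)) := by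
      simp only [mkPoint_eq_add]
      module
    rw [this]
  have hcont : ∀ t : ℝ, AEMeasurable (fun y' => u (mkPoint y' t))
      (volume.restrict (Metric.ball (0 : Section d) 1)) := fun t =>
    (hu1.continuousOn.comp
      (continuous_mkPoint.comp (Continuous.prodMk_left t)).continuousOn
      fun y' hy' => mkPoint_mem_unitCylinder.2 hy').aemeasurable measurableSet_ball
  calc ∫⁻ x' in crossSection Ω L, ‖w (mkPoint x' L)‖ₑ ^ 2
      ≤ C₂ * ∫⁻ y' in Metric.ball (0 : Section d) 1, ‖u (mkPoint y' L)‖ₑ ^ 2 :=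
        (hC₂ L fun x => ‖w x‖ₑ ^ 2).1
    _ = C₂ * ∫⁻ y' in Metric.ball (0 : Section d) 1,
          ‖u (mkPoint y' (-L)) + (u (mkPoint y' L) - u (mkPoint y' (-L)))‖ₑ ^ 2 := by
        simp
    _ ≤ C₂ * (2 * (∫⁻ y' in Metric.ball (0 : Section d) 1, ‖u (mkPoint y' (-L))‖ₑ ^ 2) +
          2 * ∫⁻ y' in Metric.ball (0 : Section d) 1,
            ‖u (mkPoint y' L) - u (mkPoint y' (-L))‖ₑ ^ 2) := by
        refine mul_le_mul_right ?_ _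
        exact lintegral_add_sq_le _
          (g := fun y' => u (mkPoint y' L) - u (mkPoint y' (-L)))
          (hcont (-L)).aestronglyMeasurable
    _ ≤ C₂ * (2 * (C₂ * ∫⁻ x' in crossSection Ω (-L), ‖w (mkPoint x' (-L))‖ₑ ^ 2) +
          2 * (ENNReal.ofReal (2 * L) * (K ^ 2 * C₁ *
            ∫⁻ x in part Ω (Ioo (-L) L), ‖gradient w x‖ₑ ^ 2))) := by
        gcongr
        · exact (hC₂ (-L) fun x => ‖w x‖ₑ ^ 2).2
        · calc _ ≤ ∫⁻ y' in Metric.ball (0 : Section d) 1, ENNReal.ofReal (2 * L) *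
                ∫⁻ t in Ioo (-L) L, ‖fderiv ℝ u (mkPoint y' t)‖ₑ ^ 2 :=
              setLIntegral_mono' measurableSet_ball hpt
            _ = ENNReal.ofReal (2 * L) *
                ∫⁻ y in part (unitCylinder d) (Ioo (-L) L), ‖fderiv ℝ u y‖ₑ ^ 2 := by
              rw [lintegral_const_mul' _ _ ENNReal.ofReal_ne_top, lintegral_part_unitCylinder
                measurableSet_Ioo hDm.aemeasurable]
            _ ≤ _ := by
              gcongr
              exact h.lintegral_fderiv_comp_le measurableSet_Ioo
                (fun g => (hC₁ _ measurableSet_Ioo g).2) hw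
    _ = ((C₂ * 2 * C₂ : ℝ≥0) : ℝ≥0∞) *
          (∫⁻ x' in crossSection Ω (-L), ‖w (mkPoint x' (-L))‖ₑ ^ 2) +
        ((C₂ * 4 * (K ^ 2 * C₁) : ℝ≥0) : ℝ≥0∞) * (ENNReal.ofReal L *
            ∫⁻ x in part Ω (Ioo (-L) L), ‖gradient w x‖ₑ ^ 2) := by
        rw [ENNReal.ofReal_mul (by norm_num), ENNReal.ofReal_ofNat]
        push_cast
        ring
    _ ≤ _ := by
        rw [mul_add]
        gcongr
        · exact le_max_left _ _
        · exact le_max_right _ _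

/-! ### Passage from smooth functions to `H_L`. -/

/-- Approximation of an element of `H_L`, together with its gradient and traces, by a smooth
function. -/
theorem HL.exists_smooth_approx {L : ℝ} (φ : HL Ω L) {ε : ℝ≥0∞} (hε : ε ≠ 0) :
    ∃ w : Space d → ℝ, ContDiff ℝ ∞ w ∧
      ∫⁻ x in part Ω (Ioo (-L) L), ‖w x - φ.val x‖ₑ ^ 2 ≤ ε ∧
      ∫⁻ x in part Ω (Ioo (-L) L), ‖gradient w x - φ.grad x‖ₑ ^ 2 ≤ ε ∧
      ∫⁻ x' in crossSection Ω (-L), ‖w (mkPoint x' (-L))‖ₑ ^ 2 ≤ ε ∧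
      ∫⁻ x' in crossSection Ω L, ‖w (mkPoint x' L) - φ.trace x'‖ₑ ^ 2 ≤ ε := by
  obtain ⟨w, hw, h1, h2, h3, h4⟩ := φ.hasTraces
  have conv : ∀ {f : ℕ → ℝ≥0∞}, Tendsto f atTop (𝓝 0) → ∀ᶠ k in atTop, f k ^ 2 ≤ ε := by
    intro f hf
    have h := ENNReal.Tendsto.pow (n := 2) hf
    rw [zero_pow two_ne_zero] at h
    exact (h.eventually_lt_const (pos_iff_ne_zero.2 hε)).mono fun k hk => hk.le
  obtain ⟨k, hk1, hk2, hk3, hk4⟩ :=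
    ((conv h1).and ((conv h2).and ((conv h3).and (conv h4)))).exists
  simp only [eLpNorm_two_sq, truncated_eq_part, sub_zero] at hk1 hk2 hk3 hk4
  exact ⟨w k, hw k, hk1, hk2, hk3, hk4⟩

theorem integrable_norm_sq {α F : Type*} [MeasurableSpace α] [NormedAddCommGroup F]
    {μ : Measure α} {f : α → F} (hf : MemLp f 2 μ) : Integrable (fun x => ‖f x‖ ^ 2) μ :=
  (memLp_two_iff_integrable_sq_norm hf.aestronglyMeasurable).1 hf

theorem ofReal_integral_norm_sq {α F : Type*} [MeasurableSpace α] [NormedAddCommGroup F]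
    {μ : Measure α} {f : α → F} (hf : MemLp f 2 μ) :
    ENNReal.ofReal (∫ x, ‖f x‖ ^ 2 ∂μ) = ∫⁻ x, ‖f x‖ₑ ^ 2 ∂μ := by
  rw [ofReal_integral_eq_lintegral_ofReal (integrable_norm_sq hf)
    (Eventually.of_forall fun x => by positivity)]
  refine lintegral_congr fun x => ?_
  rw [ENNReal.ofReal_pow (norm_nonneg _), ofReal_norm]

theorem part_mono {I J : Set ℝ} (h : I ⊆ J) : part Ω I ⊆ part Ω J := fun _ hx => ⟨hx.1, h hx.2⟩

theorem HL.memLp_val_part {L : ℝ} (φ : HL Ω L) {I : Set ℝ} (hI : I ⊆ Ioo (-L) L) :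
    MemLp φ.val 2 (volume.restrict (part Ω I)) := by
  refine φ.memLp_val.mono_measure (Measure.restrict_mono ?_ le_rfl)
  rw [truncated_eq_part]
  exact part_mono hI

theorem HL.memLp_grad_part {L : ℝ} (φ : HL Ω L) {I : Set ℝ} (hI : I ⊆ Ioo (-L) L) :
    MemLp φ.grad 2 (volume.restrict (part Ω I)) := by
  refine φ.memLp_grad.mono_measure (Measure.restrict_mono ?_ le_rfl)
  rw [truncated_eq_part]
  exact part_mono hI

theorem continuous_gradient {w : Space d → ℝ} (hw : ContDiff ℝ ∞ w) : Continuous (gradient w) :=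
  (LinearIsometryEquiv.continuous _).comp (hw.continuous_fderiv (by simp))

theorem HL.lintegral_gradient_le {L : ℝ} (φ : HL Ω L) {I : Set ℝ} (hI : I ⊆ Ioo (-L) L)
    {w : Space d → ℝ} {ε : ℝ≥0∞}
    (h : ∫⁻ x in part Ω (Ioo (-L) L), ‖gradient w x - φ.grad x‖ₑ ^ 2 ≤ ε) :
    ∫⁻ x in part Ω I, ‖gradient w x‖ₑ ^ 2 ≤
      2 * (∫⁻ x in part Ω I, ‖φ.grad x‖ₑ ^ 2) + 2 * ε := by
  have h1 := lintegral_add_sq_le (volume.restrict (part Ω I)) (f := φ.grad)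
    (g := fun x => gradient w x - φ.grad x) (φ.memLp_grad_part hI).aestronglyMeasurable
  simp only [add_sub_cancel] at h1
  refine h1.trans ?_
  gcongr
  exact (lintegral_mono_set (part_mono hI)).trans h

theorem IsFlattening.exists_lintegral_trace_le (h : IsFlattening Ω T R K) :
    ∃ C : ℝ≥0, ∀ L : ℝ, 0 < L → ∀ φ : HL Ω L,
      ∫⁻ x' in crossSection Ω L, ‖φ.trace x'‖ₑ ^ 2 ≤
        C * ENNReal.ofReal L * ∫⁻ x in part Ω (Ioo (-L) L), ‖φ.grad x‖ₑ ^ 2 := by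
  obtain ⟨C, hC⟩ := h.exists_trace_le
  refine ⟨4 * C, fun L hL φ => ?_⟩
  refine ENNReal.le_of_forall_pos_le_add fun ε hε _ => ?_
  -- `M` is the total coefficient of the approximation error in the final computation, so accuracy
  -- `ε / M` yields exactly `ε`.
  set M : ℝ≥0∞ := 2 + 2 * C + 4 * C * ENNReal.ofReal L with hM
  have hM0 : M ≠ 0 := by simp [hM]
  have hMt : M ≠ ⊤ := by
    rw [hM]
    finiteness
  obtain ⟨w, hw, -, h2, h3, h4⟩ := φ.exists_smooth_approx
    (ε := ε / M) (ENNReal.div_ne_zero.2 ⟨by simpa using hε.ne', hMt⟩)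
  have h5 := φ.lintegral_gradient_le Subset.rfl h2
  have h6 := lintegral_add_sq_le (volume.restrict (crossSection Ω L))
    (f := fun x' => w (mkPoint x' L)) (g := fun x' => φ.trace x' - w (mkPoint x' L))
    (hw.continuous.comp (continuous_mkPoint.comp
      (Continuous.prodMk_left L))).aestronglyMeasurable
  have h7 : ∫⁻ x' in crossSection Ω L, ‖φ.trace x' - w (mkPoint x' L)‖ₑ ^ 2 ≤ ε / M := by
    refine le_trans (lintegral_mono fun x' => ?_) h4
    rw [← enorm_neg, neg_sub]
  simp only [add_sub_cancel] at h6
  calc _ ≤ _ := h6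
    _ ≤ 2 * (C * (ε / M + ENNReal.ofReal L *
        (2 * (∫⁻ x in part Ω (Ioo (-L) L), ‖φ.grad x‖ₑ ^ 2) + 2 * (ε / M)))) +
        2 * (ε / M) := by
        gcongr
        refine (hC L hL w hw).trans ?_
        gcongr
    _ = ((4 * C : ℝ≥0) : ℝ≥0∞) * ENNReal.ofReal L *
          (∫⁻ x in part Ω (Ioo (-L) L), ‖φ.grad x‖ₑ ^ 2) + M * (ε / M) := by
        rw [hM]
        push_cast
        ring
    _ = _ := by rw [ENNReal.mul_div_cancel hM0 hMt]

/-- Cauchy–Schwarz on the section leaves one factor `1 / |S_L^+|`, which the uniform lower bound on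
section areas controls. -/
theorem IsFlattening.exists_trace_average_sq_le (h : IsFlattening Ω T R K) :
    ∃ C : ℝ, 0 < C ∧ ∀ L : ℝ, 0 < L → ∀ φ : HL Ω L,
      ((volume.real (crossSection Ω L))⁻¹ * ∫ x' in crossSection Ω L, φ.trace x') ^ 2 ≤
        C * L * ∫ x in part Ω (Ioo (-L) L), ‖φ.grad x‖ ^ 2 := by
  obtain ⟨C, hC⟩ := h.exists_lintegral_trace_le
  obtain ⟨c, hc, hcS⟩ := h.exists_le_volume_crossSection
  refine ⟨(C + 1) / c, by positivity, fun L hL φ => ?_⟩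
  have hg := φ.memLp_grad_part Subset.rfl
  have hE : 0 ≤ ∫ x in part Ω (Ioo (-L) L), ‖φ.grad x‖ ^ 2 := by positivity
  have h1 : (∫ x' in crossSection Ω L, φ.trace x') ^ 2 ≤
      volume.real (crossSection Ω L) *
        (C * L * ∫ x in part Ω (Ioo (-L) L), ‖φ.grad x‖ ^ 2) := by
    rw [← ENNReal.ofReal_le_ofReal_iff (by positivity)]
    calc ENNReal.ofReal ((∫ x' in crossSection Ω L, φ.trace x') ^ 2)
        = ‖∫ x' in crossSection Ω L, φ.trace x'‖ₑ ^ 2 := by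
          rw [← sq_abs, ENNReal.ofReal_pow (abs_nonneg _), ← Real.enorm_eq_ofReal_abs]
      _ ≤ (∫⁻ x' in crossSection Ω L, ‖φ.trace x'‖ₑ) ^ 2 := by
          gcongr; exact enorm_integral_le_lintegral_enorm _
      _ ≤ volume (crossSection Ω L) * ∫⁻ x' in crossSection Ω L, ‖φ.trace x'‖ₑ ^ 2 := by
          refine (sq_lintegral_le _ φ.memLp_trace.aestronglyMeasurable.enorm).trans_eq ?_
          simp
      _ ≤ volume (crossSection Ω L) * (C * ENNReal.ofReal L *
            ∫⁻ x in part Ω (Ioo (-L) L), ‖φ.grad x‖ₑ ^ 2) := by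
          gcongr; exact hC L hL φ
      _ = _ := by
          rw [ENNReal.ofReal_mul (by positivity), ENNReal.ofReal_mul (by positivity),
            ENNReal.ofReal_mul (by positivity), ofReal_integral_norm_sq hg,
            ofReal_measureReal (h.volume_crossSection_lt_top L).ne, ENNReal.ofReal_coe_nnreal]
  have hS := hcS L
  have hS0 : 0 < volume.real (crossSection Ω L) := hc.trans_le hS
  rw [mul_pow, inv_pow, inv_mul_le_iff₀ (by positivity)]
  refine h1.trans ?_
  rw [sq, mul_assoc (volume.real _) (volume.real _)]
  refine mul_le_mul_of_nonneg_left ?_ hS0.le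
  calc C * L * ∫ x in part Ω (Ioo (-L) L), ‖φ.grad x‖ ^ 2
      ≤ (C + 1) * L * ∫ x in part Ω (Ioo (-L) L), ‖φ.grad x‖ ^ 2 := by
        gcongr; linarith
    _ = c * ((C + 1) / c * L * ∫ x in part Ω (Ioo (-L) L), ‖φ.grad x‖ ^ 2) := by
        field_simp
    _ ≤ _ := by gcongr

/-- The constants `c₁`, `c₂` belong to a smooth approximant of `φ` and vary with it. Keeping an
error `ε` avoids extracting a limit of them; it disappears once they have been eliminated from the
energy estimate. -/
theorem IsFlattening.exists_HL_layer_constants (h : IsFlattening Ω T R K) :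
    ∃ C : ℝ, 0 < C ∧ ∀ (L : ℝ) (φ : HL Ω L) (z r : ℝ), 1 ≤ r → -L ≤ z - (r + 1) →
      z + (r + 1) ≤ L → ∀ ε : ℝ, 0 < ε → ∃ c₁ c₂ : ℝ,
      ∫ x in part Ω (lowerLayer z r), ‖φ.val x - c₁‖ ^ 2 ≤
        C * (∫ x in part Ω (lowerLayer z r), ‖φ.grad x‖ ^ 2) + ε ∧
      ∫ x in part Ω (upperLayer z r), ‖φ.val x - c₂‖ ^ 2 ≤
        C * (∫ x in part Ω (upperLayer z r), ‖φ.grad x‖ ^ 2) + ε ∧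
      (c₁ - c₂) ^ 2 ≤ C * r ^ 3 *
        (∫ x in part Ω (Ioo (z - (r + 1)) (z + (r + 1))), ‖φ.grad x‖ ^ 2) + ε := by
  obtain ⟨C, hC⟩ := h.exists_layer_constants
  refine ⟨4 * C + 1, by positivity, fun L φ z r hr hzl hzu ε hε => ?_⟩
  -- Large enough to dominate both error coefficients: `2 + 4C` on the layers and `2C r³` for `c₁ -
  -- c₂`.
  set M : ℝ≥0∞ := 2 + 4 * C * (1 + ENNReal.ofReal (r ^ 3)) with hM
  have hM0 : M ≠ 0 := by simp [hM]
  have hMt : M ≠ ⊤ := by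
    rw [hM]
    finiteness
  set η : ℝ≥0∞ := ENNReal.ofReal ε / M with hη
  have hMη : M * η = ENNReal.ofReal ε := ENNReal.mul_div_cancel hM0 hMt
  obtain ⟨w, hw, h1, h2, -, -⟩ := φ.exists_smooth_approx (ε := η)
    (ENNReal.div_ne_zero.2 ⟨by simpa using hε, hMt⟩)
  obtain ⟨c₁, c₂, hc₁, hc₂, hc⟩ := hC z r hr w hw
  have hlJ : lowerLayer z r ⊆ Ioo (-L) L := fun t ht =>
    ⟨by linarith [ht.1], by linarith [ht.2]⟩
  have huJ : upperLayer z r ⊆ Ioo (-L) L := fun t ht =>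
    ⟨by linarith [ht.1], by linarith [ht.2]⟩
  have hJ : Ioo (z - (r + 1)) (z + (r + 1)) ⊆ Ioo (-L) L := Ioo_subset_Ioo hzl hzu
  have layer : ∀ I : Set ℝ, I ⊆ Ioo (-L) L → MeasurableSet I → ∀ c : ℝ,
      ∫⁻ x in part Ω I, ‖w x - c‖ₑ ^ 2 ≤ C * ∫⁻ x in part Ω I, ‖gradient w x‖ₑ ^ 2 →
      ∫ x in part Ω I, ‖φ.val x - c‖ ^ 2 ≤
        (4 * C + 1) * (∫ x in part Ω I, ‖φ.grad x‖ ^ 2) + ε := by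
    intro I hI hIm c hwc
    have hfin : IsFiniteMeasure (volume.restrict (part Ω I)) := by
      refine ⟨?_⟩
      rw [Measure.restrict_apply_univ]
      refine h.volume_part_lt_top hIm ((measure_mono hI).trans_lt ?_).ne
      simp
    have hv : MemLp (fun x => φ.val x - c) 2 (volume.restrict (part Ω I)) :=
      (φ.memLp_val_part hI).sub (memLp_const c)
    have hg := φ.memLp_grad_part hI
    rw [← ENNReal.ofReal_le_ofReal_iff (by positivity), ofReal_integral_norm_sq hv,
      ENNReal.ofReal_add (by positivity) hε.le, ENNReal.ofReal_mul (by positivity),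
      ofReal_integral_norm_sq hg, ← hMη]
    have h3 := lintegral_add_sq_le (volume.restrict (part Ω I)) (f := fun x => w x - c)
      (g := fun x => φ.val x - w x) (hw.continuous.sub continuous_const).aestronglyMeasurable
    have h4 : ∫⁻ x in part Ω I, ‖φ.val x - w x‖ₑ ^ 2 ≤ η := by
      refine le_trans ?_ ((lintegral_mono_set (part_mono hI)).trans h1)
      refine lintegral_mono fun x' => ?_
      rw [← enorm_neg, neg_sub]
    have h5 : ∀ x, w x - c + (φ.val x - w x) = φ.val x - c := fun x => by ring
    simp only [h5] at h3
    refine h3.trans ?_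
    calc _ ≤ 2 * (C * (2 * (∫⁻ x in part Ω I, ‖φ.grad x‖ₑ ^ 2) + 2 * η)) + 2 * η := by
          gcongr
          refine hwc.trans ?_
          gcongr
          exact φ.lintegral_gradient_le hI h2
      _ = 4 * C * (∫⁻ x in part Ω I, ‖φ.grad x‖ₑ ^ 2) + (2 + 4 * C * (1 + 0)) * η := by ring
      _ ≤ _ := by
          rw [hM]
          gcongr
          · rw [ENNReal.ofReal_add (by positivity) (by positivity),
              ENNReal.ofReal_mul (by positivity)]
            simp
          · positivity
  refine ⟨c₁, c₂, layer _ hlJ measurableSet_Ioc c₁ hc₁, layer _ huJ measurableSet_Ico c₂ hc₂, ?_⟩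
  have hg := φ.memLp_grad_part hJ
  have hr0 : 0 ≤ r := by linarith
  rw [← ENNReal.ofReal_le_ofReal_iff (by positivity), ENNReal.ofReal_add (by positivity) hε.le,
    ENNReal.ofReal_mul (by positivity), ENNReal.ofReal_mul (by positivity),
    ofReal_integral_norm_sq hg, ← hMη, ← sq_abs, ENNReal.ofReal_pow (abs_nonneg _),
    ← Real.enorm_eq_ofReal_abs]
  refine hc.trans ?_
  calc _ ≤ C * ENNReal.ofReal (r ^ 3) *
        (2 * (∫⁻ x in part Ω (Ioo (z - (r + 1)) (z + (r + 1))), ‖φ.grad x‖ₑ ^ 2) + 2 * η) := by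
        gcongr
        exact φ.lintegral_gradient_le hJ h2
    _ = 2 * C * ENNReal.ofReal (r ^ 3) *
        (∫⁻ x in part Ω (Ioo (z - (r + 1)) (z + (r + 1))), ‖φ.grad x‖ₑ ^ 2) +
        (0 + 2 * C * (0 + ENNReal.ofReal (r ^ 3))) * η := by ring
    _ ≤ _ := by
        rw [hM]
        gcongr
        · rw [ENNReal.ofReal_add (by positivity) (by positivity),
            ENNReal.ofReal_mul (by positivity)]
          simp only [ENNReal.ofReal_ofNat, ENNReal.ofReal_coe_nnreal, ENNReal.ofReal_one]
          refine le_add_right ?_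
          gcongr
          norm_num
        · norm_num
        · norm_num
        · norm_num

/-! ### Competitors of the form `χ(xₙ) φ + ξ(xₙ)`. -/

theorem toDual_axis : InnerProductSpace.toDual ℝ (Space d) (axis d) = longitudinal d := by
  ext x
  simp [axis, lastCoord, EuclideanSpace.inner_single_left]

theorem contDiff_comp_lastCoord {χ : ℝ → ℝ} (hχ : ContDiff ℝ ∞ χ) :
    ContDiff ℝ ∞ (fun x : Space d => χ (lastCoord x)) :=
  hχ.comp (longitudinal d).contDiff

theorem gradient_mul_add {χ ξ : ℝ → ℝ} {w : Space d → ℝ} (hχ : ContDiff ℝ ∞ χ)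
    (hξ : ContDiff ℝ ∞ ξ) (hw : ContDiff ℝ ∞ w) (x : Space d) :
    gradient (fun x => χ (lastCoord x) * w x + ξ (lastCoord x)) x =
      χ (lastCoord x) • gradient w x +
        (deriv χ (lastCoord x) * w x + deriv ξ (lastCoord x)) • axis d := by
  apply HasGradientAt.gradient
  rw [hasGradientAt_iff_hasFDerivAt]
  have h1 : ∀ {f : ℝ → ℝ}, ContDiff ℝ ∞ f → HasFDerivAt (fun x : Space d => f (lastCoord x))
      (deriv f (lastCoord x) • longitudinal d) x := by
    intro f hf
    exact ((hf.differentiable (by simp)).differentiableAt.hasDerivAt).comp_hasFDerivAt x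
      (longitudinal d).hasFDerivAt
  have h2 := (hw.differentiable (by simp)).differentiableAt.hasGradientAt (x := x)
  rw [hasGradientAt_iff_hasFDerivAt] at h2
  refine (((h1 hχ).mul h2).add (h1 hξ)).congr_fderiv ?_
  simp only [map_add, map_smul, toDual_axis]
  module

theorem hasCompactSupport_gradient {ζ : Space d → ℝ} (hc : HasCompactSupport ζ) :
    HasCompactSupport (gradient ζ) :=
  (hc.fderiv (𝕜 := ℝ)).comp_left (g := (InnerProductSpace.toDual ℝ (Space d)).symm) (map_zero _)

theorem integral_gradient_eq_zero {ζ : Space d → ℝ} (hζ : ContDiff ℝ ∞ ζ)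
    (hc : HasCompactSupport ζ) : ∫ x, gradient ζ x = 0 := by
  have hint : Integrable (gradient ζ) := (continuous_gradient hζ).integrable_of_hasCompactSupport
    (hasCompactSupport_gradient hc)
  refine ext_inner_left ℝ fun v => ?_
  rw [← integral_inner hint, inner_zero_right]
  have h1 : ∀ x, inner ℝ v (gradient ζ x) = fderiv ℝ ζ x v := fun x => by
    rw [inner_gradient_right]; simp
  have hint2 : Integrable (fun x => fderiv ℝ ζ x v) := by
    simp_rw [← h1]
    exact hint.const_inner v
  have h2 := integral_mul_fderiv_eq_neg_fderiv_mul_of_integrable (μ := (volume : Measure (Space d)))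
    (f := fun _ => (1 : ℝ)) (g := ζ) (v := v) (by simp) (by simpa using hint2)
    (by simpa using hζ.continuous.integrable_of_hasCompactSupport hc)
    (fun _ _ => differentiableAt_const _)
    (fun x _ => (hζ.differentiable (by simp)).differentiableAt)
  simp_rw [h1]
  simpa using h2

theorem setIntegral_gradient_eq_zero {U : Set (Space d)} {ζ : Space d → ℝ}
    (hζ : ContDiff ℝ ∞ ζ) (hc : HasCompactSupport ζ) (hU : tsupport ζ ⊆ U) :
    ∫ x in U, gradient ζ x = 0 := by
  rw [← integral_gradient_eq_zero hζ hc]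
  refine setIntegral_eq_integral_of_forall_compl_eq_zero fun x hx => ?_
  have h1 : fderiv ℝ ζ x = 0 := by
    by_contra hne
    exact hx (hU (tsupport_fderiv_subset ℝ (subset_tsupport _ hne)))
  simp [gradient, h1]

theorem integrable_smul_of_hasCompactSupport {F : Type*} [NormedAddCommGroup F] [NormedSpace ℝ F]
    {μ : Measure (Space d)} {f : Space d → ℝ} (hf : Integrable f μ)
    {k : Space d → F} [SecondCountableTopologyEither (Space d) F] (hk : Continuous k)
    (hc : HasCompactSupport k) : Integrable (fun x => f x • k x) μ := by
  obtain ⟨C, hC⟩ := hc.exists_bound_of_continuous hk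
  exact hf.smul_bdd C hk.aestronglyMeasurable (Eventually.of_forall hC)

theorem integrable_smul_of_hasCompactSupport' {F : Type*} [NormedAddCommGroup F] [NormedSpace ℝ F]
    {μ : Measure (Space d)} {f : Space d → F} (hf : Integrable f μ)
    {k : Space d → ℝ} (hk : Continuous k)
    (hc : HasCompactSupport k) : Integrable (fun x => k x • f x) μ := by
  obtain ⟨C, hC⟩ := hc.exists_bound_of_continuous hk
  exact hf.bdd_smul C hk.aestronglyMeasurable (Eventually.of_forall hC)

/-- A bounded smooth function with bounded derivative. -/
structure IsBoundedSmooth (χ : ℝ → ℝ) : Prop where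
  contDiff : ContDiff ℝ ∞ χ
  exists_bound : ∃ B : ℝ, ∀ t, ‖χ t‖ ≤ B
  exists_bound_deriv : ∃ B : ℝ, ∀ t, ‖deriv χ t‖ ≤ B

theorem memLp_comp_lastCoord_smul {F : Type*} [NormedAddCommGroup F] [NormedSpace ℝ F]
    {μ : Measure (Space d)} {f : Space d → F} (hf : MemLp f 2 μ) {χ : ℝ → ℝ} (hχ : Continuous χ)
    (hb : ∃ B : ℝ, ∀ t, ‖χ t‖ ≤ B) : MemLp (fun x => χ (lastCoord x) • f x) 2 μ := by
  obtain ⟨B, hB⟩ := hb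
  refine hf.of_le_mul (c := B) ?_ (Eventually.of_forall fun x => ?_)
  · exact (hχ.comp continuous_lastCoord).aestronglyMeasurable.smul hf.aestronglyMeasurable
  · rw [norm_smul]
    gcongr
    exact hB _

theorem IsBoundedSmooth.continuous_deriv {χ : ℝ → ℝ} (h : IsBoundedSmooth χ) :
    Continuous (deriv χ) := h.contDiff.continuous_deriv (by simp)

/-- Product rule for weak gradients: the weak gradient of `u` is tested against `χ ζ`, and the `ξ`
terms are handled by `∫ ∇(ξ ζ) = 0`. The two integrands add up pointwise to the required one. -/
theorem IsWeakGradient.modify {U : Set (Space d)} [IsFiniteMeasure (volume.restrict U)]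
    {u : Space d → ℝ} {g : Space d → Space d} (h : IsWeakGradient U u g)
    (hu : MemLp u 2 (volume.restrict U)) (hg : MemLp g 2 (volume.restrict U))
    {χ ξ : ℝ → ℝ} (hχ : IsBoundedSmooth χ) (hξ : IsBoundedSmooth ξ)
    (hu' : MemLp (fun x => χ (lastCoord x) * u x + ξ (lastCoord x)) 2 (volume.restrict U))
    (hg' : MemLp (fun x => χ (lastCoord x) • g x +
      (deriv χ (lastCoord x) * u x + deriv ξ (lastCoord x)) • axis d) 2 (volume.restrict U)) :
    IsWeakGradient U (fun x => χ (lastCoord x) * u x + ξ (lastCoord x))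
      (fun x => χ (lastCoord x) • g x +
        (deriv χ (lastCoord x) * u x + deriv ξ (lastCoord x)) • axis d) := by
  intro ζ hζ hc hs
  have hχc := contDiff_comp_lastCoord (d := d) hχ.contDiff
  have hξc := contDiff_comp_lastCoord (d := d) hξ.contDiff
  have hζ1 : ContDiff ℝ ∞ (fun x => χ (lastCoord x) * ζ x) := hχc.mul hζ
  have hζ2 : ContDiff ℝ ∞ (fun x => ξ (lastCoord x) * ζ x) := hξc.mul hζ
  have hc1 : HasCompactSupport (fun x => χ (lastCoord x) * ζ x) := hc.mul_left
  have hc2 : HasCompactSupport (fun x => ξ (lastCoord x) * ζ x) := hc.mul_left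
  have hs1 : tsupport (fun x => χ (lastCoord x) * ζ x) ⊆ U :=
    (closure_mono (Function.support_mul_subset_right _ _)).trans hs
  have hs2 : tsupport (fun x => ξ (lastCoord x) * ζ x) ⊆ U :=
    (closure_mono (Function.support_mul_subset_right _ _)).trans hs
  have g1 : ∀ x, gradient (fun x => χ (lastCoord x) * ζ x) x =
      χ (lastCoord x) • gradient ζ x + (deriv χ (lastCoord x) * ζ x) • axis d := fun x => by
    simpa using gradient_mul_add hχ.contDiff (contDiff_const (c := (0 : ℝ))) hζ x
  have g2 : ∀ x, gradient (fun x => ξ (lastCoord x) * ζ x) x =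
      ξ (lastCoord x) • gradient ζ x + (deriv ξ (lastCoord x) * ζ x) • axis d := fun x => by
    simpa using gradient_mul_add hξ.contDiff (contDiff_const (c := (0 : ℝ))) hζ x
  have i1 := h _ hζ1 hc1 hs1
  have i2 := setIntegral_gradient_eq_zero hζ2 hc2 hs2
  have hui := hu.integrable (by norm_num)
  have hgi := hg.integrable (by norm_num)
  have hui' := hu'.integrable (by norm_num)
  have hgi' := hg'.integrable (by norm_num)
  have I1 := integrable_smul_of_hasCompactSupport hui' (continuous_gradient hζ)
    (hasCompactSupport_gradient hc)
  have I2 := integrable_smul_of_hasCompactSupport' hgi' hζ.continuous hc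
  have I3 := integrable_smul_of_hasCompactSupport hui (continuous_gradient hζ1)
    (hasCompactSupport_gradient hc1)
  have I4 := integrable_smul_of_hasCompactSupport' hgi hζ1.continuous hc1
  have I5 : Integrable (gradient fun x => ξ (lastCoord x) * ζ x) (volume.restrict U) :=
    ((continuous_gradient hζ2).integrable_of_hasCompactSupport
      (hasCompactSupport_gradient hc2)).restrict
  rw [eq_neg_iff_add_eq_zero, ← integral_add I1 I2]
  rw [eq_neg_iff_add_eq_zero, ← integral_add I3 I4] at i1
  have i3 := integral_add (I3.add I4) I5
  simp only [Pi.add_apply] at i3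
  rw [i1, i2, add_zero] at i3
  rw [← i3]
  refine integral_congr_ae (Eventually.of_forall fun x => ?_)
  simp only [g1, g2]
  module

theorem tendsto_eLpNorm_comp_lastCoord_smul {F : Type*} [NormedAddCommGroup F] [NormedSpace ℝ F]
    {μ : Measure (Space d)} {f : ℕ → Space d → F}
    (hf : Tendsto (fun k => eLpNorm (f k) 2 μ) atTop (𝓝 0)) {χ : ℝ → ℝ}
    (hb : ∃ B : ℝ, ∀ t, ‖χ t‖ ≤ B) :
    Tendsto (fun k => eLpNorm (fun x => χ (lastCoord x) • f k x) 2 μ) atTop (𝓝 0) := by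
  obtain ⟨B, hB⟩ := hb
  have h0 : Tendsto (fun k => ENNReal.ofReal B * eLpNorm (f k) 2 μ) atTop (𝓝 0) := by
    have := ENNReal.Tendsto.const_mul (a := ENNReal.ofReal B) hf (Or.inr ENNReal.ofReal_ne_top)
    rwa [mul_zero] at this
  refine tendsto_of_tendsto_of_tendsto_of_le_of_le tendsto_const_nhds h0
    (fun k => zero_le) fun k => ?_
  refine eLpNorm_le_mul_eLpNorm_of_ae_le_mul (Eventually.of_forall fun x => ?_) 2
  rw [norm_smul]
  gcongr
  exact hB _

/-- The same modification is applied to the approximating sequence, so the `ξ` terms cancel in all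
differences. The condition `ξ (-L) = 0` preserves the zero trace at the inlet. -/
theorem HasTraces.modify {L : ℝ} {u : Space d → ℝ} {g : Space d → Space d}
    {τ : Section d → ℝ} (hu : AEStronglyMeasurable u (volume.restrict (truncated Ω L)))
    (hg : AEStronglyMeasurable g (volume.restrict (truncated Ω L)))
    (h : HasTraces Ω L u g (fun _ => 0) τ)
    {χ ξ : ℝ → ℝ} (hχ : IsBoundedSmooth χ) (hξ : IsBoundedSmooth ξ) (hξ0 : ξ (-L) = 0) :
    HasTraces Ω L (fun x => χ (lastCoord x) * u x + ξ (lastCoord x))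
      (fun x => χ (lastCoord x) • g x +
        (deriv χ (lastCoord x) * u x + deriv ξ (lastCoord x)) • axis d)
      (fun _ => 0) (fun x' => χ L * τ x' + ξ L) := by
  obtain ⟨w, hw, h1, h2, h3, h4⟩ := h
  refine ⟨fun k x => χ (lastCoord x) * w k x + ξ (lastCoord x), fun k =>
    ((contDiff_comp_lastCoord hχ.contDiff).mul (hw k)).add
      (contDiff_comp_lastCoord hξ.contDiff), ?_, ?_, ?_, ?_⟩
  · refine (tendsto_eLpNorm_comp_lastCoord_smul h1 hχ.exists_bound).congr fun k => ?_
    congr 1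
    funext x
    simp only [smul_eq_mul]
    ring
  · have ha := tendsto_eLpNorm_comp_lastCoord_smul h2 hχ.exists_bound
    have hb := tendsto_eLpNorm_comp_lastCoord_smul h1 hχ.exists_bound_deriv
    have hab := ha.add hb
    rw [add_zero] at hab
    refine tendsto_of_tendsto_of_tendsto_of_le_of_le tendsto_const_nhds hab
      (fun k => zero_le) fun k => ?_
    have hm1 : AEStronglyMeasurable
        (fun x => χ (lastCoord x) • (gradient (w k) x - g x))
        (volume.restrict (truncated Ω L)) :=
      (hχ.contDiff.continuous.comp continuous_lastCoord).aestronglyMeasurable.smul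
        ((continuous_gradient (hw k)).aestronglyMeasurable.sub hg)
    have hm2 : AEStronglyMeasurable
        (fun x => (deriv χ (lastCoord x) • (w k x - u x)) • axis d)
        (volume.restrict (truncated Ω L)) :=
      ((hχ.continuous_deriv.comp continuous_lastCoord).aestronglyMeasurable.smul
        ((hw k).continuous.aestronglyMeasurable.sub hu)).smul_const _
    have he : eLpNorm (fun x => (deriv χ (lastCoord x) • (w k x - u x)) • axis d) 2
        (volume.restrict (truncated Ω L)) =
        eLpNorm (fun x => deriv χ (lastCoord x) • (w k x - u x)) 2
        (volume.restrict (truncated Ω L)) := by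
      refine eLpNorm_congr_norm_ae (Eventually.of_forall fun x => ?_)
      rw [norm_smul, norm_axis, mul_one]
    rw [← he]
    refine le_of_eq_of_le ?_ (eLpNorm_add_le hm1 hm2 (by norm_num))
    congr 1
    funext x
    rw [gradient_mul_add hχ.contDiff hξ.contDiff (hw k)]
    simp only [Pi.add_apply, smul_eq_mul]
    module
  · simp only [lastCoord_mkPoint, hξ0]
    have := ENNReal.Tendsto.const_mul (a := ‖χ (-L)‖ₑ) h3 (Or.inr (by simp))
    rw [mul_zero] at this
    refine this.congr fun k => ?_
    rw [← eLpNorm_const_smul]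
    congr 1
    funext x'
    simp
  · simp only [lastCoord_mkPoint]
    have := ENNReal.Tendsto.const_mul (a := ‖χ L‖ₑ) h4 (Or.inr (by simp))
    rw [mul_zero] at this
    refine this.congr fun k => ?_
    rw [← eLpNorm_const_smul]
    congr 1
    funext x'
    simp only [Pi.smul_apply, smul_eq_mul]
    ring

/-- The element `χ(xₙ) φ + ξ(xₙ)` of `H_L`. -/
def HL.modify {L : ℝ} (φ : HL Ω L) (hfin : volume (truncated Ω L) < ⊤)
    (hfinS : volume (crossSection Ω L) < ⊤)
    {χ ξ : ℝ → ℝ} (hχ : IsBoundedSmooth χ) (hξ : IsBoundedSmooth ξ) (hξ0 : ξ (-L) = 0) :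
    HL Ω L :=
  have : IsFiniteMeasure (volume.restrict (truncated Ω L)) := isFiniteMeasure_restrict.2 hfin.ne
  have : IsFiniteMeasure (volume.restrict (crossSection Ω L)) :=
    isFiniteMeasure_restrict.2 hfinS.ne
  have hu : MemLp (fun x => χ (lastCoord x) * φ.val x + ξ (lastCoord x)) 2
      (volume.restrict (truncated Ω L)) := by
    have h2 := memLp_comp_lastCoord_smul (μ := volume.restrict (truncated Ω L))
      (memLp_const (1 : ℝ)) hξ.contDiff.continuous hξ.exists_bound
    simp only [smul_eq_mul, mul_one] at h2
    exact (memLp_comp_lastCoord_smul φ.memLp_val hχ.contDiff.continuous hχ.exists_bound).add h2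
  have hg : MemLp (fun x => χ (lastCoord x) • φ.grad x +
      (deriv χ (lastCoord x) * φ.val x + deriv ξ (lastCoord x)) • axis d) 2
      (volume.restrict (truncated Ω L)) := by
    have h2 := memLp_comp_lastCoord_smul (μ := volume.restrict (truncated Ω L))
      (memLp_const (1 : ℝ)) hξ.continuous_deriv hξ.exists_bound_deriv
    simp only [smul_eq_mul, mul_one] at h2
    have h3 := (memLp_comp_lastCoord_smul φ.memLp_val hχ.continuous_deriv
      hχ.exists_bound_deriv).add h2
    have h4 : MemLp (fun x => (deriv χ (lastCoord x) * φ.val x + deriv ξ (lastCoord x)) • axis d) 2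
        (volume.restrict (truncated Ω L)) :=
      h3.of_le (h3.aestronglyMeasurable.smul_const _) (Eventually.of_forall fun x => by
        rw [norm_smul, norm_axis, mul_one]
        rfl)
    exact (memLp_comp_lastCoord_smul φ.memLp_grad hχ.contDiff.continuous hχ.exists_bound).add h4
  { val := fun x => χ (lastCoord x) * φ.val x + ξ (lastCoord x)
    grad := fun x => χ (lastCoord x) • φ.grad x +
      (deriv χ (lastCoord x) * φ.val x + deriv ξ (lastCoord x)) • axis d
    trace := fun x' => χ L * φ.trace x' + ξ L
    memLp_val := hu
    memLp_grad := hg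
    memLp_trace := (φ.memLp_trace.const_mul _).add (memLp_const _)
    isWeakGradient := φ.isWeakGradient.modify φ.memLp_val φ.memLp_grad hχ hξ hu hg
    hasTraces := φ.hasTraces.modify φ.memLp_val.aestronglyMeasurable
      φ.memLp_grad.aestronglyMeasurable hχ hξ hξ0 }

/-! ### Growth of the energy density, and smooth steps. -/

/-- A nondecreasing energy density, as a function of the squared speed, of linear growth. -/
structure HasLinearGrowth (F : ℝ → ℝ) (lam Lam : ℝ) : Prop where
  pos : 0 < lam
  le : lam ≤ Lam
  lower : ∀ t, 0 ≤ t → lam / 2 * t ≤ F t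
  upper : ∀ t, 0 ≤ t → F t ≤ Lam / 2 * t
  mono : MonotoneOn F (Ici 0)

/-- Being nonincreasing and eventually equal to `ρ (1 - δ) > 0`, `Θ` lies between that value and `Θ
0`; integrating gives both linear bounds and monotonicity. -/
theorem IsSubsonicTruncation.hasLinearGrowth {ρ Θ : ℝ → ℝ} {δ : ℝ} (hδ₀ : 0 < δ)
    (hδ₁ : δ < 1 / 2) (hρ : ∀ s ∈ Icc (0 : ℝ) 1, 0 < ρ s) (h : IsSubsonicTruncation ρ δ Θ) :
    HasLinearGrowth (energyDensity Θ) (ρ (1 - δ)) (Θ 0) := by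
  have hpos : 0 < ρ (1 - δ) := hρ _ ⟨by linarith, by linarith⟩
  have hlow : ∀ s, 0 ≤ s → ρ (1 - δ) ≤ Θ s := by
    intro s hs
    rw [← h.eq_const (max s 1) (by linarith [le_max_right s 1])]
    exact h.antitone hs (hs.trans (le_max_left _ _)) (le_max_left _ _)
  have hup : ∀ s, 0 ≤ s → Θ s ≤ Θ 0 := fun s hs => h.antitone (mem_Ici.2 le_rfl) hs hs
  have hint : ∀ a b, 0 ≤ a → 0 ≤ b → IntervalIntegrable Θ volume a b := by
    intro a b ha hb
    apply ContinuousOn.intervalIntegrable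
    exact h.smooth.continuousOn.mono fun s hs => (le_min ha hb).trans hs.1
  have hconst : ∀ c t : ℝ, c / 2 * t = 1 / 2 * ∫ _ in (0 : ℝ)..t, c := by
    intro c t
    rw [intervalIntegral.integral_const, smul_eq_mul]
    ring
  refine ⟨hpos, hlow 0 le_rfl, fun t ht => ?_, fun t ht => ?_, fun a ha b hb hab => ?_⟩
  · rw [hconst, energyDensity]
    gcongr
    exact intervalIntegral.integral_mono_on ht (by simp) (hint 0 t le_rfl ht)
      fun s hs => hlow s hs.1
  · rw [hconst, energyDensity]
    gcongr
    exact intervalIntegral.integral_mono_on ht (hint 0 t le_rfl ht) (by simp)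
      fun s hs => hup s hs.1
  · rw [mem_Ici] at ha hb
    rw [energyDensity, energyDensity, ← intervalIntegral.integral_add_adjacent_intervals
      (hint 0 a le_rfl ha) (hint a b ha hb)]
    have : 0 ≤ ∫ s in a..b, Θ s := intervalIntegral.integral_nonneg hab fun s hs =>
      hpos.le.trans (hlow s (ha.trans hs.1))
    linarith

theorem HasLinearGrowth.nonneg {F : ℝ → ℝ} {lam Lam : ℝ} (h : HasLinearGrowth F lam Lam) {t : ℝ}
    (ht : 0 ≤ t) : 0 ≤ F t :=
  (mul_nonneg (by linarith [h.pos]) ht).trans (h.lower t ht)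

theorem HasLinearGrowth.map_zero {F : ℝ → ℝ} {lam Lam : ℝ} (h : HasLinearGrowth F lam Lam) :
    F 0 = 0 :=
  le_antisymm (by simpa using h.upper 0 le_rfl) (by simpa using h.lower 0 le_rfl)

theorem HasLinearGrowth.integrable {F : ℝ → ℝ} {lam Lam : ℝ} (h : HasLinearGrowth F lam Lam)
    {μ : Measure (Space d)} {g : Space d → Space d} (hg : MemLp g 2 μ) :
    Integrable (fun x => F (‖g x‖ ^ 2)) μ := by
  -- Measurability of the energy comes from monotonicity, after extending `F` by a constant to
  -- negative arguments.
  have hmono : Monotone fun t => F (max t 0) := fun a b hab =>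
    h.mono (le_max_right a 0) (le_max_right b 0) (max_le_max_right 0 hab)
  have he : (fun x => F (‖g x‖ ^ 2)) = fun x => (fun t => F (max t 0)) (‖g x‖ ^ 2) := by
    funext x
    simp
  refine ((integrable_norm_sq hg).const_mul (Lam / 2)).mono' ?_ (Eventually.of_forall fun x => ?_)
  · rw [he]
    exact (hmono.measurable.comp_aemeasurable
      (hg.aestronglyMeasurable.norm.aemeasurable.pow_const 2)).aestronglyMeasurable
  · rw [Real.norm_of_nonneg (h.nonneg (by positivity))]
    exact h.upper _ (by positivity)

-- Zero is the global minimum of the transition function, so the derivative vanishes wherever it is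
-- attained, including the endpoint `t = 0`.
open Real in
theorem deriv_smoothTransition_of_nonpos {t : ℝ} (ht : t ≤ 0) : deriv smoothTransition t = 0 := by
  apply IsLocalMin.deriv_eq_zero
  refine Eventually.of_forall fun s => ?_
  rw [smoothTransition.zero_of_nonpos ht]
  exact smoothTransition.nonneg s

open Real in
theorem deriv_smoothTransition_of_one_le {t : ℝ} (ht : 1 ≤ t) : deriv smoothTransition t = 0 := by
  apply IsLocalMax.deriv_eq_zero
  refine Eventually.of_forall fun s => ?_
  rw [smoothTransition.one_of_one_le ht]
  exact smoothTransition.le_one s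

open Real in
theorem exists_abs_deriv_smoothTransition_le :
    ∃ M : ℝ, 0 < M ∧ ∀ t, |deriv smoothTransition t| ≤ M := by
  have hc : Continuous (deriv smoothTransition) :=
    (smoothTransition.contDiff (n := 1)).continuous_deriv le_rfl
  obtain ⟨M, hM⟩ := isCompact_Icc.exists_bound_of_continuousOn (s := Icc (0 : ℝ) 1) hc.continuousOn
  refine ⟨max M 1, by positivity, fun t => ?_⟩
  by_cases h0 : t ≤ 0
  · rw [deriv_smoothTransition_of_nonpos h0, abs_zero]; positivity
  by_cases h1 : 1 ≤ t
  · rw [deriv_smoothTransition_of_one_le h1, abs_zero]; positivity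
  · exact (hM t ⟨by linarith, by linarith⟩).trans (le_max_left _ _)

/-- The smooth step from `0` at `s` to `1` at `s + 1`. -/
def step (s t : ℝ) : ℝ := Real.smoothTransition (t - s)

theorem deriv_step (s t : ℝ) : deriv (step s) t = deriv Real.smoothTransition (t - s) := by
  unfold step
  exact deriv_comp_sub_const (f := Real.smoothTransition) s t

theorem contDiff_step (s : ℝ) : ContDiff ℝ ∞ (step s) :=
  (Real.smoothTransition.contDiff (n := ⊤)).comp (contDiff_id.sub contDiff_const)

theorem differentiable_step (s : ℝ) : Differentiable ℝ (step s) :=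
  (contDiff_step s).differentiable (by simp)

theorem step_of_le {s t : ℝ} (h : t ≤ s) : step s t = 0 :=
  Real.smoothTransition.zero_of_nonpos (by linarith)

theorem step_of_ge {s t : ℝ} (h : s + 1 ≤ t) : step s t = 1 :=
  Real.smoothTransition.one_of_one_le (by linarith)

theorem deriv_step_of_le {s t : ℝ} (h : t ≤ s) : deriv (step s) t = 0 := by
  rw [deriv_step, deriv_smoothTransition_of_nonpos (by linarith)]

theorem deriv_step_of_ge {s t : ℝ} (h : s + 1 ≤ t) : deriv (step s) t = 0 := by
  rw [deriv_step, deriv_smoothTransition_of_one_le (by linarith)]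

theorem abs_step_le (s t : ℝ) : |step s t| ≤ 1 := by
  rw [step, abs_of_nonneg (Real.smoothTransition.nonneg _)]
  exact Real.smoothTransition.le_one _

theorem deriv_lin_step (c₀ c₁ c₂ s₁ s₂ t : ℝ) :
    deriv (fun t => c₀ + c₁ * step s₁ t + c₂ * step s₂ t) t =
      c₁ * deriv (step s₁) t + c₂ * deriv (step s₂) t := by
  have h := (((differentiable_step s₁ t).hasDerivAt.const_mul c₁).const_add c₀).add
    ((differentiable_step s₂ t).hasDerivAt.const_mul c₂)
  exact h.deriv

theorem isBoundedSmooth_lin_step (c₀ c₁ c₂ s₁ s₂ : ℝ) :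
    IsBoundedSmooth fun t => c₀ + c₁ * step s₁ t + c₂ * step s₂ t := by
  obtain ⟨M, -, hM⟩ := exists_abs_deriv_smoothTransition_le
  refine ⟨(contDiff_const.add (contDiff_const.mul (contDiff_step s₁))).add
    (contDiff_const.mul (contDiff_step s₂)), ⟨|c₀| + |c₁| + |c₂|, fun t => ?_⟩,
    ⟨|c₁| * M + |c₂| * M, fun t => ?_⟩⟩
  · rw [Real.norm_eq_abs]
    refine (abs_add_three _ _ _).trans ?_
    rw [abs_mul, abs_mul]
    gcongr
    · exact mul_le_of_le_one_right (abs_nonneg _) (abs_step_le _ _)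
    · exact mul_le_of_le_one_right (abs_nonneg _) (abs_step_le _ _)
  · rw [deriv_lin_step, Real.norm_eq_abs, deriv_step, deriv_step]
    refine (abs_add_le _ _).trans ?_
    rw [abs_mul, abs_mul]
    gcongr
    · exact hM _
    · exact hM _

/-! ### Comparison with the competitor and decay of the energy. -/

theorem norm_smul_add_smul_axis_sq_le {χ η v M : ℝ} (hχ : |χ| ≤ 1) (hη : |η| ≤ M)
    (g : Space d) : ‖χ • g + (η * v) • axis d‖ ^ 2 ≤ 2 * ‖g‖ ^ 2 + 2 * M ^ 2 * ‖v‖ ^ 2 := by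
  have h1 : ‖χ • g + (η * v) • axis d‖ ≤ ‖g‖ + M * ‖v‖ := by
    refine (norm_add_le _ _).trans ?_
    rw [norm_smul, norm_smul, norm_axis, mul_one, norm_mul, Real.norm_eq_abs, Real.norm_eq_abs η]
    gcongr
    exact mul_le_of_le_one_left (norm_nonneg _) hχ
  calc _ ≤ (‖g‖ + M * ‖v‖) ^ 2 := by gcongr
    _ ≤ _ := by nlinarith [sq_nonneg (‖g‖ - M * ‖v‖)]

/-- The half-open layers and the open middle slab partition the larger slab exactly, so no null sets
have to be discarded. -/
theorem setIntegral_part_eq_add {z r : ℝ} (hr : 0 < r) (hΩ : IsOpen Ω) {f : Space d → ℝ}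
    (hf : IntegrableOn f (part Ω (Ioo (z - (r + 1)) (z + (r + 1))))) :
    ∫ x in part Ω (Ioo (z - (r + 1)) (z + (r + 1))), f x =
      (∫ x in part Ω (lowerLayer z r), f x) + (∫ x in part Ω (Ioo (z - r) (z + r)), f x) +
        ∫ x in part Ω (upperLayer z r), f x := by
  have hu : part Ω (Ioo (z - (r + 1)) (z + (r + 1))) =
      (part Ω (lowerLayer z r) ∪ part Ω (Ioo (z - r) (z + r))) ∪ part Ω (upperLayer z r) := by
    ext x
    simp only [part, lowerLayer, upperLayer, mem_union, mem_ofPred_eq, mem_Ioo, mem_Ioc, mem_Ico]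
    constructor
    · rintro ⟨hx, h1, h2⟩
      rcases le_or_gt (lastCoord x) (z - r) with h3 | h3
      · exact Or.inl (Or.inl ⟨hx, by linarith, h3⟩)
      · rcases lt_or_ge (lastCoord x) (z + r) with h4 | h4
        · exact Or.inl (Or.inr ⟨hx, h3, h4⟩)
        · exact Or.inr ⟨hx, h4, by linarith⟩
    · rintro ((⟨hx, h1, h2⟩ | ⟨hx, h1, h2⟩) | ⟨hx, h1, h2⟩) <;>
        exact ⟨hx, by linarith, by linarith⟩
  have hupp : MeasurableSet (part Ω (upperLayer z r)) := measurableSet_part hΩ measurableSet_Ico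
  rw [hu] at hf ⊢
  rw [setIntegral_union _ hupp (hf.mono_set subset_union_left)
    (hf.mono_set subset_union_right), setIntegral_union _
    (measurableSet_part hΩ measurableSet_Ioo)
    (hf.mono_set (subset_union_left.trans subset_union_left))
    (hf.mono_set (subset_union_right.trans subset_union_left))]
  · rw [Set.disjoint_left]
    rintro x ⟨-, h1, h2⟩ ⟨-, h3, h4⟩
    linarith
  · rw [Set.disjoint_left]
    rintro x (⟨-, h1, h2⟩ | ⟨-, h1, h2⟩) ⟨-, h3, h4⟩ <;> linarith

/-- Comparison of a minimizer with the competitor which is constant in the slab of half-width `r`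
around height `z`, and which differs from the minimizer by a constant above this slab. -/
theorem IsMinimizer.comparison {Θ : ℝ → ℝ} {lam Lam m₀ L M : ℝ} (hΩ : IsOpen Ω)
    (hF : HasLinearGrowth (energyDensity Θ) lam Lam) (hm₀ : 0 < m₀)
    (hfin : volume (truncated Ω L) < ⊤) (hfinS : volume (crossSection Ω L) < ⊤)
    (hS : 0 < volume.real (crossSection Ω L))
    (hM : ∀ t, |deriv Real.smoothTransition t| ≤ M) {φ : HL Ω L} (hφ : IsMinimizer Ω Θ m₀ L φ)
    {z r : ℝ} (hr : 0 < r) (hzl : -L ≤ z - (r + 1)) (hzu : z + (r + 1) ≤ L) (c₁ c₂ : ℝ) :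
    lam / 2 * ∫ x in part Ω (Ioo (z - (r + 1)) (z + (r + 1))), ‖φ.grad x‖ ^ 2 ≤
      Lam * ((∫ x in part Ω (lowerLayer z r), ‖φ.grad x‖ ^ 2) +
        ∫ x in part Ω (upperLayer z r), ‖φ.grad x‖ ^ 2) +
      Lam * M ^ 2 * ((∫ x in part Ω (lowerLayer z r), ‖φ.val x - c₁‖ ^ 2) +
        ∫ x in part Ω (upperLayer z r), ‖φ.val x - c₂‖ ^ 2) + m₀ * |c₁ - c₂| := by
  set J : Set ℝ := Ioo (z - (r + 1)) (z + (r + 1)) with hJ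
  have hJL : J ⊆ Ioo (-L) L := Ioo_subset_Ioo hzl hzu
  have hlJ : lowerLayer z r ⊆ J := fun t ht => ⟨by linarith [ht.1], by linarith [ht.2]⟩
  have huJ : upperLayer z r ⊆ J := fun t ht => ⟨by linarith [ht.1], by linarith [ht.2]⟩
  -- From bottom to top `χ` takes the values `1, 0, 1` and `ξ` the values `0, c₁, c₁ - c₂`. With `s`
  -- the relevant step, the competitor is `φ - s (φ - c₁)` in the lower layer and `c₁ + s (φ - c₂)`
  -- in the upper one, so derivatives of the cut-off multiply only `φ - c₁` and `φ - c₂`.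
  set χ : ℝ → ℝ := fun t => 1 + (-1) * step (z - r - 1) t + 1 * step (z + r) t with hχdef
  set ξ : ℝ → ℝ := fun t => 0 + c₁ * step (z - r - 1) t + (-c₂) * step (z + r) t with hξdef
  have hξ0 : ξ (-L) = 0 := by
    simp only [hξdef]
    rw [step_of_le (by linarith), step_of_le (by linarith)]; ring
  set ψ : HL Ω L := φ.modify hfin hfinS (isBoundedSmooth_lin_step 1 (-1) 1 (z - r - 1) (z + r))
    (isBoundedSmooth_lin_step 0 c₁ (-c₂) (z - r - 1) (z + r)) hξ0 with hψ
  have hGrad : ∀ x, ψ.grad x = χ (lastCoord x) • φ.grad x +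
      (deriv χ (lastCoord x) * φ.val x + deriv ξ (lastCoord x)) • axis d := fun x => rfl
  have hχd : ∀ t, deriv χ t = (-1) * deriv (step (z - r - 1)) t + 1 * deriv (step (z + r)) t :=
    fun t => deriv_lin_step 1 (-1) 1 (z - r - 1) (z + r) t
  have hξd : ∀ t, deriv ξ t = c₁ * deriv (step (z - r - 1)) t + (-c₂) * deriv (step (z + r)) t :=
    fun t => deriv_lin_step 0 c₁ (-c₂) (z - r - 1) (z + r) t
  have htrace : ∀ x', ψ.trace x' = φ.trace x' + (c₁ - c₂) := by
    intro x'
    change χ L * φ.trace x' + ξ L = _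
    simp only [hχdef, hξdef]
    rw [step_of_ge (by linarith), step_of_ge (by linarith)]; ring
  -- the gradient of the competitor
  have hout : ∀ x, lastCoord x ∉ J → ψ.grad x = φ.grad x := by
    intro x hx
    rw [hGrad, hχd, hξd]
    simp only [hχdef]
    rcases le_or_gt (lastCoord x) (z - (r + 1)) with h1 | h1
    · rw [step_of_le (by linarith), step_of_le (by linarith), deriv_step_of_le (by linarith),
        deriv_step_of_le (by linarith)]
      simp
    · have h2 : z + (r + 1) ≤ lastCoord x := by
        by_contra h3
        exact hx ⟨h1, not_le.1 h3⟩
      rw [step_of_ge (by linarith), step_of_ge (by linarith), deriv_step_of_ge (by linarith),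
        deriv_step_of_ge (by linarith)]
      simp
  have hmid : ∀ x, lastCoord x ∈ Ioo (z - r) (z + r) → ψ.grad x = 0 := by
    intro x hx
    rw [hGrad, hχd, hξd]
    simp only [hχdef]
    rw [step_of_ge (by linarith [hx.1]), step_of_le (by linarith [hx.2]),
      deriv_step_of_ge (by linarith [hx.1]), deriv_step_of_le (by linarith [hx.2])]
    simp
  have hlow : ∀ x, lastCoord x ∈ lowerLayer z r → ‖ψ.grad x‖ ^ 2 ≤
      2 * ‖φ.grad x‖ ^ 2 + 2 * M ^ 2 * ‖φ.val x - c₁‖ ^ 2 := by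
    intro x hx
    have h1 := Real.smoothTransition.nonneg (lastCoord x - (z - r - 1))
    have h2 := Real.smoothTransition.le_one (lastCoord x - (z - r - 1))
    have h3 : ψ.grad x = (1 - step (z - r - 1) (lastCoord x)) • φ.grad x +
        (-deriv (step (z - r - 1)) (lastCoord x) * (φ.val x - c₁)) • axis d := by
      rw [hGrad, hχd, hξd]
      simp only [hχdef]
      rw [step_of_le (by linarith [hx.2] : lastCoord x ≤ z + r),
        deriv_step_of_le (by linarith [hx.2] : lastCoord x ≤ z + r)]
      module
    rw [h3]
    apply norm_smul_add_smul_axis_sq_le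
    · rw [abs_le, step]; constructor <;> linarith
    · rw [abs_neg, deriv_step]; exact hM _
  have hupp : ∀ x, lastCoord x ∈ upperLayer z r → ‖ψ.grad x‖ ^ 2 ≤
      2 * ‖φ.grad x‖ ^ 2 + 2 * M ^ 2 * ‖φ.val x - c₂‖ ^ 2 := by
    intro x hx
    have h3 : ψ.grad x = step (z + r) (lastCoord x) • φ.grad x +
        (deriv (step (z + r)) (lastCoord x) * (φ.val x - c₂)) • axis d := by
      rw [hGrad, hχd, hξd]
      simp only [hχdef]
      rw [step_of_ge (by linarith [hx.1] : z - r - 1 + 1 ≤ lastCoord x),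
        deriv_step_of_ge (by linarith [hx.1] : z - r - 1 + 1 ≤ lastCoord x)]
      module
    rw [h3]
    apply norm_smul_add_smul_axis_sq_le
    · exact abs_step_le _ _
    · rw [deriv_step]; exact hM _
  -- comparison of the functionals
  have hfinC : IsFiniteMeasure (volume.restrict (crossSection Ω L)) :=
    isFiniteMeasure_restrict.2 hfinS.ne
  have hmin := hφ ψ
  simp only [functional] at hmin
  simp_rw [htrace] at hmin
  -- The trace is shifted by a constant, and the factor `1 / |S_L^+|` turns the change of the
  -- boundary term into exactly `m₀ (c₁ - c₂)`.
  rw [integral_add (φ.memLp_trace.integrable (by norm_num)) (integrable_const _),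
    setIntegral_const, mul_add, smul_eq_mul, ← mul_assoc (m₀ / _), div_mul_cancel₀ _ hS.ne',
    truncated_eq_part] at hmin
  have hIφ : IntegrableOn (fun x => energyDensity Θ (‖φ.grad x‖ ^ 2)) (part Ω (Ioo (-L) L)) :=
    hF.integrable (φ.memLp_grad_part Subset.rfl)
  have hIψ : IntegrableOn (fun x => energyDensity Θ (‖ψ.grad x‖ ^ 2)) (part Ω (Ioo (-L) L)) :=
    hF.integrable (ψ.memLp_grad_part Subset.rfl)
  have hJm : MeasurableSet (part Ω J) := measurableSet_part hΩ measurableSet_Ioo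
  have hLm : MeasurableSet (part Ω (Ioo (-L) L)) := measurableSet_part hΩ measurableSet_Ioo
  have hdiff : ∫ x in part Ω (Ioo (-L) L) \ part Ω J, energyDensity Θ (‖φ.grad x‖ ^ 2) =
      ∫ x in part Ω (Ioo (-L) L) \ part Ω J, energyDensity Θ (‖ψ.grad x‖ ^ 2) :=
    setIntegral_congr_fun (hLm.diff hJm) fun x hx => by
      simp only [hout x fun hxJ => hx.2 ⟨hx.1.1, hxJ⟩]
  have hJsub := part_mono (Ω := Ω) hJL
  -- The energies outside `J` coincide, so only their parts in `J` remain to be compared.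
  rw [← integral_inter_add_sdiff hJm hIφ, ← integral_inter_add_sdiff hJm hIψ,
    inter_eq_self_of_subset_right hJsub, hdiff] at hmin
  have hIφJ := hIφ.mono_set hJsub
  have hIψJ := hIψ.mono_set hJsub
  rw [setIntegral_part_eq_add hr hΩ hIψJ] at hmin
  have hmid0 : ∫ x in part Ω (Ioo (z - r) (z + r)), energyDensity Θ (‖ψ.grad x‖ ^ 2) = 0 := by
    rw [setIntegral_congr_fun (g := fun _ => (0 : ℝ)) (measurableSet_part hΩ measurableSet_Ioo)
      fun x hx => by
        simp only [hmid x hx.2, norm_zero]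
        rw [zero_pow two_ne_zero, hF.map_zero]]
    simp
  have hLam : 0 < Lam := hF.pos.trans_le hF.le
  have layer : ∀ I : Set ℝ, MeasurableSet I → I ⊆ J → ∀ c : ℝ,
      (∀ x, lastCoord x ∈ I → ‖ψ.grad x‖ ^ 2 ≤
        2 * ‖φ.grad x‖ ^ 2 + 2 * M ^ 2 * ‖φ.val x - c‖ ^ 2) →
      ∫ x in part Ω I, energyDensity Θ (‖ψ.grad x‖ ^ 2) ≤
        Lam * (∫ x in part Ω I, ‖φ.grad x‖ ^ 2) +
          Lam * M ^ 2 * ∫ x in part Ω I, ‖φ.val x - c‖ ^ 2 := by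
    intro I hI hIJ c hc
    have hIL := hIJ.trans hJL
    have hfinI : IsFiniteMeasure (volume.restrict (part Ω I)) := by
      refine isFiniteMeasure_restrict.2 ((measure_mono ?_).trans_lt hfin).ne
      rw [truncated_eq_part]
      exact part_mono hIL
    have i1 := (integrable_norm_sq (φ.memLp_grad_part hIL)).const_mul Lam
    have i2 := (integrable_norm_sq ((φ.memLp_val_part hIL).sub (memLp_const c))).const_mul
      (Lam * M ^ 2)
    simp only [Pi.sub_apply] at i2
    rw [← integral_const_mul, ← integral_const_mul, ← integral_add i1 i2]
    refine setIntegral_mono_on (hIψJ.mono_set (part_mono hIJ)) (i1.add i2)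
      (measurableSet_part hΩ hI) fun x hx => ?_
    refine (hF.upper _ (by positivity)).trans ?_
    calc Lam / 2 * ‖ψ.grad x‖ ^ 2 ≤
        Lam / 2 * (2 * ‖φ.grad x‖ ^ 2 + 2 * M ^ 2 * ‖φ.val x - c‖ ^ 2) := by
          gcongr; exact hc x hx.2
      _ = _ := by ring
  have hL1 := layer (lowerLayer z r) measurableSet_Ioc hlJ c₁ hlow
  have hL2 := layer (upperLayer z r) measurableSet_Ico huJ c₂ hupp
  have hlower : lam / 2 * ∫ x in part Ω J, ‖φ.grad x‖ ^ 2 ≤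
      ∫ x in part Ω J, energyDensity Θ (‖φ.grad x‖ ^ 2) := by
    rw [← integral_const_mul]
    exact setIntegral_mono_on ((integrable_norm_sq (φ.memLp_grad_part hJL)).const_mul _) hIφJ hJm
      fun x _ => hF.lower _ (by positivity)
  have habs : -(m₀ * (c₁ - c₂)) ≤ m₀ * |c₁ - c₂| := by
    rw [← mul_neg]
    exact mul_le_mul_of_nonneg_left (neg_le_abs _) hm₀.le
  linarith

/-- The energy of a minimizer is controlled by its mean trace. -/
theorem IsMinimizer.energy_le {Θ : ℝ → ℝ} {lam Lam m₀ L : ℝ} (hΩ : IsOpen Ω)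
    (hF : HasLinearGrowth (energyDensity Θ) lam Lam)
    (hfin : volume (truncated Ω L) < ⊤) (hfinS : volume (crossSection Ω L) < ⊤)
    {φ : HL Ω L} (hφ : IsMinimizer Ω Θ m₀ L φ) :
    lam / 2 * ∫ x in part Ω (Ioo (-L) L), ‖φ.grad x‖ ^ 2 ≤
      m₀ * ((volume.real (crossSection Ω L))⁻¹ * ∫ x' in crossSection Ω L, φ.trace x') := by
  -- The competitor is zero, realized as `0 · φ + 0`.
  have h0 : IsBoundedSmooth fun _ => (0 : ℝ) :=
    ⟨contDiff_const, ⟨0, by simp⟩, ⟨0, by simp⟩⟩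
  have hmin := hφ (φ.modify hfin hfinS h0 h0 rfl)
  simp only [functional, HL.modify, truncated_eq_part] at hmin
  simp [hF.map_zero] at hmin
  have hlower : lam / 2 * ∫ x in part Ω (Ioo (-L) L), ‖φ.grad x‖ ^ 2 ≤
      ∫ x in part Ω (Ioo (-L) L), energyDensity Θ (‖φ.grad x‖ ^ 2) := by
    rw [← integral_const_mul]
    exact setIntegral_mono_on
      ((integrable_norm_sq (φ.memLp_grad_part Subset.rfl)).const_mul _)
      (hF.integrable (φ.memLp_grad_part Subset.rfl)) (measurableSet_part hΩ measurableSet_Ioo)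
      fun x _ => hF.lower _ (by positivity)
  rw [← mul_assoc, ← div_eq_mul_inv]
  linarith

theorem mul_le_mul_sq_add {x y α : ℝ} (hα : 0 < α) : x * y ≤ α * y ^ 2 + x ^ 2 / (4 * α) := by
  have : α * y ^ 2 + x ^ 2 / (4 * α) - x * y = (2 * α * y - x) ^ 2 / (4 * α) := by
    field_simp
    ring
  have h : 0 ≤ (2 * α * y - x) ^ 2 / (4 * α) := by positivity
  linarith

/-- The decay of the energy from a slab to a smaller one. -/
theorem IsFlattening.exists_energy_decay (h : IsFlattening Ω T R K) {Θ : ℝ → ℝ} {lam Lam : ℝ}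
    (hF : HasLinearGrowth (energyDensity Θ) lam Lam) :
    ∃ θ D : ℝ, 0 < θ ∧ θ < 1 ∧ 0 < D ∧ ∀ m₀ : ℝ, 0 < m₀ → ∀ (L : ℝ) (φ : HL Ω L),
      IsMinimizer Ω Θ m₀ L φ → ∀ z r : ℝ, 1 ≤ r → -L ≤ z - (r + 1) → z + (r + 1) ≤ L →
      ∫ x in part Ω (Ioo (z - r) (z + r)), ‖φ.grad x‖ ^ 2 ≤
        θ * (∫ x in part Ω (Ioo (z - (r + 1)) (z + (r + 1))), ‖φ.grad x‖ ^ 2) +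
          D * r ^ 3 * m₀ ^ 2 := by
  obtain ⟨C, hC, hlayer⟩ := h.exists_HL_layer_constants
  obtain ⟨c, hc, hcS⟩ := h.exists_le_volume_crossSection
  obtain ⟨M, -, hM⟩ := exists_abs_deriv_smoothTransition_le
  have hlam := hF.pos
  have hLam : 0 < Lam := hlam.trans_le hF.le
  set A : ℝ := Lam * (1 + M ^ 2 * C) with hA
  have hA0 : 0 < A := by positivity
  have hAlam : lam ≤ A := by
    have : 0 ≤ Lam * (M ^ 2 * C) := by positivity
    rw [hA]; linarith [hF.le]
  -- Hole filling: comparison and Young give `(lam / 2) E ≤ A (E - E₀) + (lam / 4) E + (C / lam) r³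
  -- m₀²`. Moving `A E₀` to the left and dividing by `A` produces these constants.
  refine ⟨1 - lam / (4 * A), C / (lam * A), ?_, ?_, by positivity, ?_⟩
  · rw [sub_pos, div_lt_one (by positivity)]; linarith
  · rw [sub_lt_self_iff]; positivity
  intro m₀ hm₀ L φ hφ z r hr hzl hzu
  have hr0 : 0 < r := by linarith
  have hfin : volume (truncated Ω L) < ⊤ := by
    rw [truncated_eq_part]
    exact h.volume_part_lt_top measurableSet_Ioo (by simp)
  have hJL : Ioo (z - (r + 1)) (z + (r + 1)) ⊆ Ioo (-L) L := Ioo_subset_Ioo hzl hzu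
  have hsplit := setIntegral_part_eq_add (f := fun x => ‖φ.grad x‖ ^ 2) hr0 h.isOpen
    (integrable_norm_sq (φ.memLp_grad_part hJL))
  set E := ∫ x in part Ω (Ioo (z - (r + 1)) (z + (r + 1))), ‖φ.grad x‖ ^ 2 with hE
  set E₁ := ∫ x in part Ω (lowerLayer z r), ‖φ.grad x‖ ^ 2 with hE₁
  set E₂ := ∫ x in part Ω (upperLayer z r), ‖φ.grad x‖ ^ 2 with hE₂
  set E₀ := ∫ x in part Ω (Ioo (z - r) (z + r)), ‖φ.grad x‖ ^ 2
  have key : A * E₀ ≤ (A - lam / 4) * E + C / lam * r ^ 3 * m₀ ^ 2 := by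
    refine le_of_forall_pos_le_add fun η hη => ?_
    -- `N` is the sum of the coefficients with which the error `η / N` enters: once per layer, and
    -- once through `(c₁ - c₂)²`.
    set N : ℝ := 2 * Lam * M ^ 2 + lam / (4 * C * r ^ 3) with hN
    have hN0 : 0 < N := by positivity
    obtain ⟨c₁, c₂, h1, h2, h3⟩ := hlayer L φ z r hr hzl hzu (η / N) (by positivity)
    have hcomp := hφ.comparison h.isOpen hF hm₀ hfin (h.volume_crossSection_lt_top L)
      (hc.trans_le (hcS L)) hM hr0 hzl hzu c₁ c₂
    -- Young's parameter is tuned so that the bound `C r³ E` on `(c₁ - c₂)²` contributes `(lam / 4)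
    -- E`, half of the left-hand side.
    have hy := mul_le_mul_sq_add (x := m₀) (y := |c₁ - c₂|) (α := lam / (4 * C * r ^ 3))
      (by positivity)
    rw [sq_abs] at hy
    have h4 : lam / (4 * C * r ^ 3) * (c₁ - c₂) ^ 2 ≤
        lam / 4 * E + lam / (4 * C * r ^ 3) * (η / N) := by
      calc _ ≤ lam / (4 * C * r ^ 3) * (C * r ^ 3 * E + η / N) := by gcongr
        _ = _ := by field_simp
    have h5 : m₀ ^ 2 / (4 * (lam / (4 * C * r ^ 3))) = C / lam * r ^ 3 * m₀ ^ 2 := by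
      field_simp
    have h6 : Lam * M ^ 2 * ((∫ x in part Ω (lowerLayer z r), ‖φ.val x - c₁‖ ^ 2) +
        ∫ x in part Ω (upperLayer z r), ‖φ.val x - c₂‖ ^ 2) ≤
        Lam * M ^ 2 * ((C * E₁ + η / N) + (C * E₂ + η / N)) := by
      gcongr
    have h7 : N * (η / N) = η := by field_simp
    rw [hN, add_mul] at h7
    rw [← hE, ← hE₁, ← hE₂] at hcomp
    have h8 : E₁ + E₂ = E - E₀ := by linarith
    have h9 : A * (E₁ + E₂) = Lam * (E₁ + E₂) + Lam * M ^ 2 * (C * E₁ + C * E₂) := by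
      rw [hA]; ring
    have h10 : A * (E₁ + E₂) = A * E - A * E₀ := by rw [h8]; ring
    linarith
  have h10 : E₀ ≤ ((A - lam / 4) * E + C / lam * r ^ 3 * m₀ ^ 2) / A := by
    rw [le_div_iff₀ hA0]; linarith
  refine h10.trans_eq ?_
  field_simp

/-- With `E` the total energy and `a` the mean trace, comparison with zero gives `E ≲ m₀ a`, while
the trace inequality gives `a² ≲ L E`. Hence `E² ≲ m₀² L E`, and a factor `E` cancels unless it is
zero. -/
theorem IsFlattening.exists_energy_le (h : IsFlattening Ω T R K) {Θ : ℝ → ℝ} {lam Lam : ℝ}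
    (hF : HasLinearGrowth (energyDensity Θ) lam Lam) :
    ∃ C : ℝ, 0 < C ∧ ∀ m₀ : ℝ, 0 < m₀ → ∀ L : ℝ, 0 < L → ∀ φ : HL Ω L,
      IsMinimizer Ω Θ m₀ L φ →
      ∫ x in part Ω (Ioo (-L) L), ‖φ.grad x‖ ^ 2 ≤ C * L * m₀ ^ 2 := by
  obtain ⟨C, hC, htr⟩ := h.exists_trace_average_sq_le
  have hlam := hF.pos
  refine ⟨4 * C / lam ^ 2, by positivity, fun m₀ hm₀ L hL φ hφ => ?_⟩
  have hfin : volume (truncated Ω L) < ⊤ := by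
    rw [truncated_eq_part]
    exact h.volume_part_lt_top measurableSet_Ioo (by simp)
  have h1 := hφ.energy_le h.isOpen hF hfin (h.volume_crossSection_lt_top L)
  have h2 := htr L hL φ
  set E := ∫ x in part Ω (Ioo (-L) L), ‖φ.grad x‖ ^ 2
  set a := (volume.real (crossSection Ω L))⁻¹ * ∫ x' in crossSection Ω L, φ.trace x'
  have hE : 0 ≤ E := by positivity
  have h3 : (lam / 2 * E) ^ 2 ≤ m₀ ^ 2 * (C * L * E) := by
    calc (lam / 2 * E) ^ 2 ≤ (m₀ * a) ^ 2 := by gcongr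
      _ = m₀ ^ 2 * a ^ 2 := by ring
      _ ≤ _ := by gcongr
  rcases hE.eq_or_lt with h0 | h0
  · rw [← h0]; positivity
  · have h4 : lam ^ 2 / 4 * E ≤ m₀ ^ 2 * (C * L) := by
      refine le_of_mul_le_mul_right ?_ h0
      nlinarith
    calc E = 4 / lam ^ 2 * (lam ^ 2 / 4 * E) := by field_simp
      _ ≤ 4 / lam ^ 2 * (m₀ ^ 2 * (C * L)) := by gcongr
      _ = _ := by ring

/-! ### Iteration over growing slabs and conclusion. -/

/-- Unrolling the recursion from `k = 1`: the source term of step `k = i + 1` arrives discounted by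
`θ ^ i`. -/
theorem le_of_decay {q : ℕ → ℝ} {θ D : ℝ} (hθ : 0 ≤ θ) {n : ℕ}
    (h : ∀ k, 1 ≤ k → k < n → q k ≤ θ * q (k + 1) + D * (k : ℝ) ^ 3) :
    ∀ j, j + 1 ≤ n → q 1 ≤ θ ^ j * q (j + 1) +
      D * ∑ i ∈ Finset.range j, ((i : ℝ) + 1) ^ 3 * θ ^ i := by
  intro j
  induction j with
  | zero => intro _; simp
  | succ j ih =>
    intro hj
    have h1 := ih (by omega)
    have h2 := h (j + 1) (by omega) (by omega)
    have h3 := mul_le_mul_of_nonneg_left h2 (pow_nonneg hθ j)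
    rw [Finset.sum_range_succ]
    push_cast at h3 ⊢
    rw [pow_succ]
    linarith

theorem IsFlattening.exists_local_energy_le (h : IsFlattening Ω T R K) {Θ : ℝ → ℝ} {lam Lam : ℝ}
    (hF : HasLinearGrowth (energyDensity Θ) lam Lam) :
    ∃ C : ℝ, 0 < C ∧ ∀ m₀ : ℝ, 0 < m₀ → ∀ L : ℝ, 2 ≤ L → ∀ φ : HL Ω L,
      IsMinimizer Ω Θ m₀ L φ → ∀ z : ℝ, |z| < L / 2 →
      ∫ x in part Ω (Ioo (z - 1) (z + 1)), ‖φ.grad x‖ ^ 2 ≤ C * m₀ ^ 2 := by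
  obtain ⟨θ, D, hθ0, hθ1, hD, hdecay⟩ := h.exists_energy_decay hF
  obtain ⟨C, hC, henergy⟩ := h.exists_energy_le hF
  have hsum : Summable fun i : ℕ => ((i : ℝ) + 1) ^ 3 * θ ^ i := by
    have h1 := (summable_nat_add_iff 1).2 (summable_pow_mul_geometric_of_norm_lt_one 3
      (r := θ) (by rw [Real.norm_of_nonneg hθ0.le]; exact hθ1))
    refine (h1.mul_left θ⁻¹).congr fun i => ?_
    push_cast
    rw [pow_succ]
    field_simp
    ring
  have hnn : ∀ i : ℕ, 0 ≤ ((i : ℝ) + 1) ^ 3 * θ ^ i := fun i => by positivity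
  set S : ℝ := ∑' i : ℕ, ((i : ℝ) + 1) ^ 3 * θ ^ i with hS
  have hS0 : 0 < S := hsum.tsum_pos hnn 0 (by simp)
  refine ⟨4 * C * S + D * S, by positivity, fun m₀ hm₀ L hL φ hφ z hz => ?_⟩
  -- Since `|z| < L / 2`, all slabs of half-width up to `n` stay inside the truncated nozzle; `L ≥
  -- 2` ensures that at least the slab of half-width one is reached.
  set n := ⌊L / 2⌋₊ with hn
  have hn1 : 1 ≤ n := Nat.le_floor (by push_cast; linarith)
  have hnL : (n : ℝ) ≤ L / 2 := Nat.floor_le (by linarith)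
  have hLn : L / 2 < n + 1 := Nat.lt_floor_add_one _
  obtain ⟨j, hj⟩ : ∃ j, n = j + 1 := ⟨n - 1, by omega⟩
  obtain ⟨hz1, hz2⟩ := abs_lt.1 hz
  set q : ℕ → ℝ := fun k => ∫ x in part Ω (Ioo (z - k) (z + k)), ‖φ.grad x‖ ^ 2 with hq
  have hq1 := le_of_decay (q := q) (D := D * m₀ ^ 2) hθ0.le (n := n) (fun k hk hkn => by
    have hk' : (1 : ℝ) ≤ k := by exact_mod_cast hk
    have hkn' : (k : ℝ) + 1 ≤ n := by exact_mod_cast hkn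
    have := hdecay m₀ hm₀ L φ hφ z k hk' (by linarith) (by linarith)
    simp only [hq]
    push_cast
    linarith) j hj.ge
  have hqn : q (j + 1) ≤ C * L * m₀ ^ 2 := by
    refine le_trans ?_ (henergy m₀ hm₀ L (by linarith) φ hφ)
    rw [← hj]
    refine setIntegral_mono_set (integrable_norm_sq (φ.memLp_grad_part Subset.rfl))
      (Eventually.of_forall fun x => by positivity) (LE.le.eventuallyLE ?_)
    exact part_mono (Ioo_subset_Ioo (by linarith) (by linarith))
  have hq1' : q 1 = ∫ x in part Ω (Ioo (z - 1) (z + 1)), ‖φ.grad x‖ ^ 2 := by simp [hq]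
  rw [← hq1']
  have hjn : (n : ℝ) = j + 1 := by exact_mod_cast hj
  have hj0 : (0 : ℝ) ≤ j := Nat.cast_nonneg j
  -- `L < 2 (n + 1) ≤ 4 n ≤ 4 n³` with `n = j + 1`. In this form `θ ^ j L` is bounded by four times
  -- a single term of the series `S`, so no separate estimate of `n θⁿ` is needed.
  have hL4 : L ≤ 4 * ((j : ℝ) + 1) ^ 3 := by
    have : (j : ℝ) + 1 ≤ ((j : ℝ) + 1) ^ 3 := le_self_pow₀ (by linarith) (by norm_num)
    linarith
  have hterm : θ ^ j * (C * L * m₀ ^ 2) ≤ 4 * C * S * m₀ ^ 2 := by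
    calc θ ^ j * (C * L * m₀ ^ 2) ≤ θ ^ j * (C * (4 * ((j : ℝ) + 1) ^ 3) * m₀ ^ 2) := by gcongr
      _ = 4 * C * (((j : ℝ) + 1) ^ 3 * θ ^ j) * m₀ ^ 2 := by ring
      _ ≤ _ := by
        gcongr
        exact hsum.le_tsum j fun i _ => hnn i
  calc q 1 ≤ _ := hq1
    _ ≤ θ ^ j * (C * L * m₀ ^ 2) + D * m₀ ^ 2 * S := by
        gcongr
        exact hsum.sum_le_tsum _ fun i _ => hnn i
    _ ≤ 4 * C * S * m₀ ^ 2 + D * m₀ ^ 2 * S := by gcongr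
    _ = _ := by ring

end Nozzle

end

theorem mainTheorem5 (d : ℕ) (hd : 1 ≤ d)
    (Ω : Set (Nozzle.Space d)) (hΩ : Nozzle.IsNozzle Ω)
    (p ρ : ℝ → ℝ) (hp : Nozzle.IsPressureLaw p) (hρ : Nozzle.IsDensitySpeedRelation p ρ)
    (δ : ℝ) (hδ₀ : 0 < δ) (hδ₁ : δ < 1 / 2)
    (Θ : ℝ → ℝ) (hΘ : Nozzle.IsSubsonicTruncation ρ δ Θ) :
    ∃ C : ℝ, 0 < C ∧
      ∀ m₀ : ℝ, 0 < m₀ →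
      ∀ L : ℝ, 2 ≤ L →
      ∀ φ : Nozzle.HL Ω L, Nozzle.IsMinimizer Ω Θ m₀ L φ →
      ∀ x₀ ∈ Ω, |Nozzle.lastCoord x₀| < L / 2 →
        (volume.real (Nozzle.slab Ω x₀ 1))⁻¹ * ∫ x in Nozzle.slab Ω x₀ 1, ‖φ.grad x‖ ^ 2
          ≤ C * m₀ ^ 2 := by
  obtain ⟨T, R, K, h⟩ := hΩ.exists_isFlattening
  have hF := hΘ.hasLinearGrowth hδ₀ hδ₁ hρ.pos
  obtain ⟨C, hC, hloc⟩ := h.exists_local_energy_le hF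
  obtain ⟨c, hc, hvol⟩ := h.exists_le_volume_part
  refine ⟨c⁻¹ * C, by positivity, fun m₀ hm₀ L hL φ hφ x₀ _ hx₀ => ?_⟩
  rw [Nozzle.slab_eq_part]
  have h1 := hloc m₀ hm₀ L hL φ hφ _ hx₀
  -- The slab has length 2, so its volume is even at least `2c`.
  have h2 : c ≤ volume.real
      (Nozzle.part Ω (Ioo (Nozzle.lastCoord x₀ - 1) (Nozzle.lastCoord x₀ + 1))) := by
    refine le_trans ?_ (hvol (Nozzle.lastCoord x₀ - 1) (Nozzle.lastCoord x₀ + 1) (by linarith))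
    nlinarith
  rw [mul_assoc]
  gcongr
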